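/- Let $X$ be a complex Hilbert space, $Y$ a complex Banach space, and let $-A$ be the generator of a strongly continuous semigroup $(T(t))_{t\ge 0}$ on $X$. Suppose that there is a constant $\omega>0$ such that $A+\omega$ is accretive, i.e. $\operatorname{Re}\langle (A+\omega)x,x\rangle\ge 0$ for all $x\in D(A)$, and let $C:D(A)\to Y$ be linear and bounded for the graph norm $\|x\|+\|Ax\|$ of $D(A)$. Suppose that there is $\delta>0$ such that for every $x\in D(A)$ the vector $(A+\omega)^{-1/2}x$ is defined and belongs to $D(A)$, and $$\|C(A+\omega)^{-1/2}x\|_Y\ \ge\ \delta\,\|x\| .$$ Here $(A+\omega)^{-1/2}x=\frac1\pi\int_0^\infty s^{-1/2}(s+A+\omega)^{-1}x\,ds$, where $x$ is in the domain of $(A+\omega)^{-1/2}$ when this integral (improper at $0$) converges in $X$. Then $C$ is exactly observable in finite time: there are $\eta>0$ and $m>0$ such that $$\int_0^\eta \|C\,T(t)x\|_Y^2\,dt\ \ge\ m^2\qquad\text{for all } x\in D(A)\text{ with }\|x\|=1 .$$ -/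

import Mathlib

open Filter Topology MeasureTheory
open scoped NNReal

/-- A strongly continuous semigroup of bounded linear operators on `X`. -/
structure C0Semigroup (X : Type*) [NormedAddCommGroup X] [NormedSpace ℂ X] where
  op : ℝ≥0 → X →L[ℂ] X
  op_zero : op 0 = ContinuousLinearMap.id ℂ X
  op_add : ∀ s t : ℝ≥0, op (s + t) = (op s).comp (op t)
  strongly_continuous : ∀ x : X, Continuous fun t : ℝ≥0 => op t x

namespace C0Semigroup

variable {X : Type*} [NormedAddCommGroup X] [NormedSpace ℂ X]

/-- The difference quotient `(T(t)x - x) / t`. -/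
noncomputable def diffQuot (T : C0Semigroup X) (x : X) (t : ℝ≥0) : X :=
  (((t : ℝ)⁻¹ : ℝ) : ℂ) • (T.op t x - x)

theorem diffQuot_add (T : C0Semigroup X) (x y : X) (t : ℝ≥0) :
    T.diffQuot (x + y) t = T.diffQuot x t + T.diffQuot y t := by
  simp only [diffQuot, map_add, ← smul_add]
  congr 1
  abel

theorem diffQuot_smul (T : C0Semigroup X) (c : ℂ) (x : X) (t : ℝ≥0) :
    T.diffQuot (c • x) t = c • T.diffQuot x t := by
  simp only [diffQuot, map_smul, ← smul_sub]
  rw [smul_comm]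

/-- The infinitesimal generator of `T`: its domain is the set of all `x` for which
`lim_{t → 0+} (T(t)x - x) / t` exists, and its value at `x` is that limit. -/
noncomputable def generator (T : C0Semigroup X) : X →ₗ.[ℂ] X where
  domain :=
    { carrier := {x | ∃ y, Tendsto (T.diffQuot x) (𝓝[>] 0) (𝓝 y)}
      add_mem' := by
        rintro a b ⟨y, hy⟩ ⟨z, hz⟩
        exact ⟨y + z, (hy.add hz).congr fun t => (T.diffQuot_add a b t).symm⟩
      zero_mem' := ⟨0, tendsto_const_nhds.congr fun t => by simp [diffQuot]⟩
      smul_mem' := by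
        rintro c a ⟨y, hy⟩
        exact ⟨c • y, (hy.const_smul c).congr fun t => (T.diffQuot_smul c a t).symm⟩ }
  toFun :=
    { toFun := fun x => x.2.choose
      map_add' := fun a b => tendsto_nhds_unique (a + b).2.choose_spec
        ((a.2.choose_spec.add b.2.choose_spec).congr fun t => (T.diffQuot_add a b t).symm)
      map_smul' := fun c a => tendsto_nhds_unique (c • a).2.choose_spec
        ((a.2.choose_spec.const_smul c).congr fun t => (T.diffQuot_smul c a t).symm) }

theorem op_mem_generator_domain (T : C0Semigroup X) (s : ℝ≥0) {x : X}
    (hx : x ∈ T.generator.domain) : T.op s x ∈ T.generator.domain := by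
  obtain ⟨y, hy⟩ := hx
  refine ⟨T.op s y, (((T.op s).continuous.tendsto y).comp hy).congr fun t => ?_⟩
  have h : T.op t (T.op s x) = T.op s (T.op t x) := by
    rw [← ContinuousLinearMap.comp_apply, ← T.op_add, add_comm, T.op_add,
      ContinuousLinearMap.comp_apply]
  simp [diffQuot, h]

/-- If `-A` is the generator of `T`, then `T(s)` maps `D(A)` into `D(A)`; this is `T(s)` as a
map of `D(A)`. -/
def onDomain (T : C0Semigroup X) {A : X →ₗ.[ℂ] X} (hA : T.generator = -A) (s : ℝ≥0)
    (x : A.domain) : A.domain :=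
  ⟨T.op s x, by
    have h : T.generator.domain = A.domain := by rw [hA, LinearPMap.neg_domain]
    exact h.le (T.op_mem_generator_domain s (h.ge x.2))⟩

/-- `C` is exactly `L²`-observable in time `η`: the infimum of `∫₀^η ‖C T(t) x‖² dt` over the
unit vectors `x` of `D(A)` is positive. -/
def ExactlyObservableInTime {Y : Type*} [NormedAddCommGroup Y] [NormedSpace ℂ Y]
    (T : C0Semigroup X) {A : X →ₗ.[ℂ] X} (hA : T.generator = -A) (C : A.domain →ₗ[ℂ] Y)
    (η : ℝ) : Prop :=
  ∃ m : ℝ, 0 < m ∧ ∀ x : A.domain, ‖(x : X)‖ = 1 →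
    m ^ 2 ≤ ∫ t in (0 : ℝ)..η, ‖C (T.onDomain hA t.toNNReal x)‖ ^ 2

end C0Semigroup

namespace LinearPMap

/-- The operator `B + c` with domain `D(B)`. -/
def addScalar {X : Type*} [NormedAddCommGroup X] [NormedSpace ℂ X]
    (B : X →ₗ.[ℂ] X) (c : ℝ) : X →ₗ.[ℂ] X :=
  ((c : ℂ) • (LinearMap.id : X →ₗ[ℂ] X)) +ᵥ B

/-- `B` is accretive: `Re ⟨B x, x⟩ ≥ 0` on `D(B)`. -/
def IsAccretive {X : Type*} [NormedAddCommGroup X] [InnerProductSpace ℂ X]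
    (B : X →ₗ.[ℂ] X) : Prop :=
  ∀ x : B.domain, 0 ≤ (inner ℂ (B x) (x : X)).re

/-- Boundedness of an operator on `D(B)` for the graph norm `‖x‖ + ‖B x‖`. -/
def IsBoundedOnDomain {X Y : Type*} [NormedAddCommGroup X] [NormedSpace ℂ X]
    [NormedAddCommGroup Y] [NormedSpace ℂ Y]
    (B : X →ₗ.[ℂ] X) (C : B.domain →ₗ[ℂ] Y) : Prop :=
  ∃ M : ℝ, ∀ x : B.domain, ‖C x‖ ≤ M * (‖(x : X)‖ + ‖B x‖)

/-- `(s + B)⁻¹ x`, whenever `s + B` is a bijection of `D(B)` onto `X`. -/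
noncomputable def invAdd {X : Type*} [NormedAddCommGroup X] [NormedSpace ℂ X]
    (B : X →ₗ.[ℂ] X) (s : ℝ) (x : X) : X :=
  (Function.invFun (fun z : (B.addScalar s).domain => B.addScalar s z) x :
    (B.addScalar s).domain)

/-- `x` belongs to the domain of `B^{-1/2}` and `B^{-1/2} x = y`, by the Balakrishnan formula
`B^{-1/2} x = (1/π) ∫₀^∞ s^{-1/2} (s + B)⁻¹ x ds`, the integral being improper at `0`.
For an injective m-accretive (more generally, sectorial) operator `B` on a Hilbert space this is
the inverse of the square root of `B`, with its full domain; if `B` is boundedly invertible, the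
integral converges absolutely for all `x` in `X`. -/
def HasNegSqrt {X : Type*} [NormedAddCommGroup X] [NormedSpace ℂ X]
    (B : X →ₗ.[ℂ] X) (x y : X) : Prop :=
  Tendsto
    (fun ε : ℝ => (Real.pi⁻¹ : ℝ) • ∫ s in Set.Ioi ε, (s ^ (-(1 / 2) : ℝ) : ℝ) • B.invAdd s x)
    (𝓝[>] 0) (𝓝 y)

end LinearPMap

/-! Put B = A + ω and S(t) = e^{-ωt} T(t). Accretivity makes S a contraction semigroup with
generator -B. If z = B^{-1/2} y with y, z in D(A), then B^{-1/2} S(t) y = S(t) z, so ‖C T(t) z‖ ≥ ‖C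
S(t) z‖ ≥ δ ‖S(t) y‖. Everything therefore rests on an observability inequality for B^{1/2} itself,
‖z‖² ≤ K ∫₀¹ ‖S(t) y‖² dt (`exists_norm_sq_le_integral_of_hasNegSqrt`).

For this the Balakrishnan integral is cut at s = 1. The part R over s > 1 is treated as a half-order
fractional integral of the damped orbit e^{-t} S(t) y. With N_x(t) = ‖e^{-t} S(t) x‖², the
increments N(t) - N(t + τ) are squared norms under the defect operator of e^{-τ} S(τ). A weighted
Hardy inequality compares the increments of N_{Ry} with those of N_y multiplied by t; summing both
sides, dividing by τ and letting τ tend to 0 gives ‖R y‖² ≤ (16/π) ∫₀^∞ N_y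
(`norm_sq_negSqrtTrunc_one_le`). No derivative of the orbit is needed.

The part w over s < 1 is written as (w - S(1) w) + S(1) w. The factor I - S(1) supplies a B that
tames (s + B)⁻¹ near s = 0, and S(1) w is controlled by ‖S(1) y‖ because B^{-1/2} is bounded: by
Banach-Steinhaus, being defined on D(B) is enough (`exists_norm_le_of_hasNegSqrt`).

The vectors (1 + B)⁻¹ B^{-1/2} (1 + B)⁻¹ x are dense in D(A) for the graph norm, by
`dense_range_negSqrt`, and graph-norm continuity of the output carries the inequality to all of
D(A). -/

open Set in
theorem integral_Ioi_comp_add_left {E : Type*} [NormedAddCommGroup E] [NormedSpace ℝ E]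
    (f : ℝ → E) (t a : ℝ) : ∫ u in Ioi a, f (t + u) = ∫ u in Ioi (t + a), f u := by
  have h := (measurePreserving_add_left volume t).setIntegral_preimage_emb
    (measurableEmbedding_addLeft t) f (Ioi (t + a))
  rwa [show (fun u => t + u) ⁻¹' Ioi (t + a) = Ioi a by ext; simp] at h

/-- A strongly continuous semigroup of contractions, indexed by the real line; only the values
at nonnegative times matter. -/
structure ContractionSemigroup (X : Type*) [NormedAddCommGroup X] [NormedSpace ℂ X] where
  op : ℝ → X →L[ℂ] X
  op_zero : ∀ x, op 0 x = x
  op_add : ∀ {s t : ℝ}, 0 ≤ s → 0 ≤ t → ∀ x, op (s + t) x = op s (op t x)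
  continuous_op : ∀ x : X, Continuous fun t => op t x
  norm_op_le : ∀ t x, ‖op t x‖ ≤ ‖x‖

/-! ### Generator and resolvent of a contraction semigroup. -/

namespace ContractionSemigroup

open Set

variable {X : Type*} [NormedAddCommGroup X] [NormedSpace ℂ X]
  (S : ContractionSemigroup X)

theorem op_comm {s t : ℝ} (hs : 0 ≤ s) (ht : 0 ≤ t) (x : X) :
    S.op s (S.op t x) = S.op t (S.op s x) := by
  rw [← S.op_add hs ht, ← S.op_add ht hs, add_comm]

theorem norm_op_anti {s t : ℝ} (hs : 0 ≤ s) (hst : s ≤ t) (x : X) :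
    ‖S.op t x‖ ≤ ‖S.op s x‖ := by
  have h := S.op_add (sub_nonneg.2 hst) hs x
  rw [sub_add_cancel] at h
  rw [h]
  exact S.norm_op_le _ _

/-- `x` belongs to the domain of `B`, where `-B` is the generator of `S`, and `B x = z`. -/
def HasGen (x z : X) : Prop :=
  Tendsto (fun t : ℝ => t⁻¹ • (S.op t x - x)) (𝓝[>] 0) (𝓝 (-z))

variable {S} in
theorem HasGen.unique {x z z' : X} (h : S.HasGen x z) (h' : S.HasGen x z') : z = z' :=
  neg_injective (tendsto_nhds_unique h h')

variable {S} in
theorem HasGen.map {x z : X} (h : S.HasGen x z) (L : X →L[ℂ] X)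
    (hL : ∀ t, 0 ≤ t → ∀ x, L (S.op t x) = S.op t (L x)) : S.HasGen (L x) (L z) := by
  have h1 := (L.continuous.tendsto _).comp h
  rw [map_neg] at h1
  refine h1.congr' ?_
  filter_upwards [self_mem_nhdsWithin] with t ht
  have : L (t⁻¹ • (S.op t x - x)) = t⁻¹ • L (S.op t x - x) := by
    rw [← Complex.coe_smul, map_smul, Complex.coe_smul]
  simp only [Function.comp, this, map_sub, hL t (le_of_lt ht)]

variable {S} in
theorem HasGen.op {x z : X} (h : S.HasGen x z) {t : ℝ} (ht : 0 ≤ t) :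
    S.HasGen (S.op t x) (S.op t z) :=
  h.map (S.op t) fun _ hs x => S.op_comm ht hs x

variable {S} in
theorem HasGen.sub_op_eq_integral [CompleteSpace X] {x z : X} (h : S.HasGen x z) {t : ℝ} (ht : 0 ≤ t) :
    x - S.op t x = ∫ r in (0 : ℝ)..t, S.op r z := by
  have key : ∫ r in (0 : ℝ)..t, -S.op r z = S.op t x - S.op 0 x := by
    -- The definition of the generator yields only right derivatives of the orbit, which suffice for
    -- this form of the fundamental theorem.
    refine intervalIntegral.integral_eq_sub_of_hasDeriv_right_of_le ht
      (S.continuous_op x).continuousOn (fun r hr => ?_)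
      ((S.continuous_op z).neg.intervalIntegrable _ _)
    rw [hasDerivWithinAt_iff_tendsto_slope' (by simp)]
    have h1 := h.op hr.1.le
    have h2 : Tendsto (fun u : ℝ => u - r) (𝓝[>] r) (𝓝[>] 0) := by
      refine tendsto_nhdsWithin_iff.2 ⟨?_, ?_⟩
      · have : Tendsto (fun u : ℝ => u - r) (𝓝 r) (𝓝 (r - r)) :=
          (continuous_id.sub continuous_const).tendsto r
        rw [sub_self] at this
        exact this.mono_left nhdsWithin_le_nhds
      · filter_upwards [self_mem_nhdsWithin] with u hu
        exact sub_pos.2 (mem_Ioi.1 hu)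
    refine (h1.comp h2).congr' ?_
    filter_upwards [self_mem_nhdsWithin] with u hu
    rw [slope_def_module]
    have h3 := S.op_add (sub_nonneg.2 (le_of_lt hu)) hr.1.le x
    rw [sub_add_cancel] at h3
    simp only [Function.comp, h3]
  rw [intervalIntegral.integral_neg, S.op_zero] at key
  rw [← neg_sub, ← key, neg_neg]

theorem continuous_exp_smul_op (s : ℝ) (x : X) :
    Continuous fun t => Real.exp (-s * t) • S.op t x :=
  (Real.continuous_exp.comp (continuous_const.mul continuous_id)).smul (S.continuous_op x)

theorem norm_exp_smul_op_le (s t : ℝ) (x : X) :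
    ‖Real.exp (-s * t) • S.op t x‖ ≤ Real.exp (-s * t) * ‖x‖ := by
  rw [norm_smul, Real.norm_eq_abs, Real.abs_exp]
  gcongr
  exact S.norm_op_le t x

theorem integrableOn_exp_smul_op {s : ℝ} (hs : 0 < s) (x : X) (a : ℝ) :
    IntegrableOn (fun t => Real.exp (-s * t) • S.op t x) (Ioi a) := by
  refine Integrable.mono' ((exp_neg_integrableOn_Ioi a hs).mul_const ‖x‖)
    (S.continuous_exp_smul_op s x).aestronglyMeasurable ?_
  exact Eventually.of_forall fun t => S.norm_exp_smul_op_le s t x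

/-- The resolvent `(s + B)⁻¹`, for `s > 0`, of the operator `B` such that `-B` generates `S`. -/
noncomputable def res (s : ℝ) : X →L[ℂ] X :=
  if hs : 0 < s then
    LinearMap.mkContinuous
      { toFun := fun x => ∫ t in Ioi (0 : ℝ), Real.exp (-s * t) • S.op t x
        map_add' := fun x y => by
          rw [← integral_add (S.integrableOn_exp_smul_op hs x 0)
            (S.integrableOn_exp_smul_op hs y 0)]
          simp only [map_add, smul_add]
        map_smul' := fun c x => by
          rw [RingHom.id_apply, ← integral_smul]
          simp only [map_smul, smul_comm c] }
      s⁻¹ (fun x => by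
        refine (norm_integral_le_of_norm_le ((exp_neg_integrableOn_Ioi 0 hs).mul_const ‖x‖)
          (Eventually.of_forall fun t => S.norm_exp_smul_op_le s t x)).trans ?_
        rw [integral_mul_const, integral_exp_mul_Ioi (neg_lt_zero.2 hs)]
        simp)
  else 0

variable {s : ℝ}

theorem res_apply (hs : 0 < s) (x : X) :
    S.res s x = ∫ t in Ioi (0 : ℝ), Real.exp (-s * t) • S.op t x := by
  rw [res, dif_pos hs]; rfl

theorem norm_res_le (hs : 0 < s) (x : X) : ‖S.res s x‖ ≤ s⁻¹ * ‖x‖ := by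
  rw [S.res_apply hs]
  refine (norm_integral_le_of_norm_le ((exp_neg_integrableOn_Ioi 0 hs).mul_const ‖x‖)
    (Eventually.of_forall fun t => S.norm_exp_smul_op_le s t x)).trans ?_
  rw [integral_mul_const, integral_exp_mul_Ioi (neg_lt_zero.2 hs)]
  simp

theorem map_res [CompleteSpace X] (hs : 0 < s) (L : X →L[ℂ] X) (x : X) :
    L (S.res s x) = ∫ t in Ioi (0 : ℝ), Real.exp (-s * t) • L (S.op t x) := by
  rw [S.res_apply hs, ← L.integral_comp_comm (S.integrableOn_exp_smul_op hs x 0)]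
  congr 1
  ext t
  rw [← Complex.coe_smul, map_smul, Complex.coe_smul]

theorem map_res_comm [CompleteSpace X] (hs : 0 < s) (L : X →L[ℂ] X)
    (hL : ∀ t, 0 ≤ t → ∀ x, L (S.op t x) = S.op t (L x)) (x : X) :
    L (S.res s x) = S.res s (L x) := by
  rw [S.map_res hs, S.res_apply hs]
  refine setIntegral_congr_fun measurableSet_Ioi fun t ht => ?_
  simp only [hL t (le_of_lt ht)]

theorem res_op [CompleteSpace X] (hs : 0 < s) {t : ℝ} (ht : 0 ≤ t) (x : X) :
    S.res s (S.op t x) = S.op t (S.res s x) :=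
  (S.map_res_comm hs (S.op t) (fun _ hr x => S.op_comm ht hr x) x).symm

theorem res_comm [CompleteSpace X] {r : ℝ} (hs : 0 < s) (hr : 0 < r) (x : X) :
    S.res s (S.res r x) = S.res r (S.res s x) :=
  S.map_res_comm hr (S.res s) (fun _ ht x => S.res_op hs ht x) x

theorem hasGen_res [CompleteSpace X] (hs : 0 < s) (x : X) : S.HasGen (S.res s x) (x - s • S.res s x) := by
  set f : ℝ → X := fun t => Real.exp (-s * t) • S.op t x with hf
  have hfc : Continuous f := S.continuous_exp_smul_op s x
  -- Shifting the Laplace integral by t turns the orbit of a resolvent vector into a function that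
  -- is visibly differentiable at 0.
  have h1 : ∀ t : ℝ, 0 ≤ t →
      S.op t (S.res s x) = Real.exp (s * t) • (S.res s x - ∫ u in (0 : ℝ)..t, f u) := by
    intro t ht
    have h3 : S.res s x - ∫ u in (0 : ℝ)..t, f u = ∫ u in Ioi t, f u := by
      rw [S.res_apply hs x, ← intervalIntegral.integral_interval_add_Ioi
        (S.integrableOn_exp_smul_op hs x 0) (S.integrableOn_exp_smul_op hs x t),
        add_sub_cancel_left]
    rw [h3, S.map_res hs]
    have h2 := integral_Ioi_comp_add_left f t 0
    rw [add_zero] at h2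
    rw [← h2, ← integral_smul]
    refine setIntegral_congr_fun measurableSet_Ioi fun u hu => ?_
    simp only [hf, S.op_add ht (le_of_lt hu), smul_smul, ← Real.exp_add]
    congr 2
    ring
  have hd : HasDerivAt (fun t : ℝ => Real.exp (s * t) • (S.res s x - ∫ u in (0 : ℝ)..t, f u))
      (Real.exp (s * 0) • (0 - f 0) +
        (Real.exp (s * 0) * (s * 1)) • (S.res s x - ∫ u in (0 : ℝ)..0, f u)) 0 := by
    have he : HasDerivAt (fun t : ℝ => Real.exp (s * t)) (Real.exp (s * 0) * (s * 1)) 0 :=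
      ((hasDerivAt_id 0).const_mul s).exp
    refine he.smul (HasDerivAt.sub (hasDerivAt_const _ _) ?_)
    exact intervalIntegral.integral_hasDerivAt_right (hfc.intervalIntegrable _ _)
      (hfc.stronglyMeasurableAtFilter _ _) hfc.continuousAt
  rw [hasDerivAt_iff_tendsto_slope_zero] at hd
  have hd' := hd.mono_left (nhdsWithin_mono 0 (fun t (ht : t ∈ Ioi (0 : ℝ)) => (ne_of_gt ht : t ≠ 0)))
  unfold HasGen
  convert hd'.congr' ?_ using 2
  · simp [hf, S.op_zero]; abel
  · filter_upwards [self_mem_nhdsWithin] with t ht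
    simp only [zero_add, h1 t (le_of_lt ht)]
    simp

variable {S} in
-- The resolvent commutes with S, hence with B, so the right inverse given by `hasGen_res` is also a
-- left inverse.
theorem HasGen.res_eq [CompleteSpace X] {x z : X} (h : S.HasGen x z) (hs : 0 < s) : S.res s (s • x + z) = x := by
  have h1 := h.map (S.res s) fun t ht x => S.res_op hs ht x
  have h2 := h1.unique (S.hasGen_res hs x)
  rw [map_add, h2, ← Complex.coe_smul, map_smul]
  simp

theorem res_sub_res [CompleteSpace X] {r : ℝ} (hs : 0 < s) (hr : 0 < r) (x : X) :
    S.res s x - S.res r x = (r - s) • S.res s (S.res r x) := by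
  have h := (S.hasGen_res hr x).res_eq hs
  rw [map_add, map_sub, ← Complex.coe_smul, ← Complex.coe_smul, map_smul, map_smul,
    Complex.coe_smul, Complex.coe_smul] at h
  rw [sub_smul, sub_eq_iff_eq_add]
  calc S.res s x = r • S.res s (S.res r x) - s • S.res s (S.res r x) +
        (s • S.res s (S.res r x) + (S.res s x - r • S.res s (S.res r x))) := by abel
    _ = _ := by rw [h]

/-- The vector on the left is B (s + B)⁻¹ x; the point is that its bound does not degenerate as s
tends to 0. -/
theorem norm_sub_smul_res_le (hs : 0 < s) (x : X) : ‖x - s • S.res s x‖ ≤ 2 * ‖x‖ := by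
  refine (norm_sub_le _ _).trans ?_
  rw [norm_smul, Real.norm_of_nonneg hs.le]
  have := mul_le_mul_of_nonneg_left (S.norm_res_le hs x) hs.le
  rw [mul_inv_cancel_left₀ hs.ne'] at this
  linarith

theorem continuousOn_res [CompleteSpace X] (x : X) : ContinuousOn (fun s => S.res s x) (Ioi 0) := by
  intro r hr
  refine ContinuousAt.continuousWithinAt ?_
  have hr : 0 < r := hr
  have hev : ∀ᶠ s in 𝓝 r, ‖S.res s x - S.res r x‖ ≤ |r - s| * ((r / 2)⁻¹ * (r⁻¹ * ‖x‖)) := by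
    filter_upwards [lt_mem_nhds (half_lt_self hr)] with s hs
    have hs0 : 0 < s := (half_pos hr).trans hs
    rw [S.res_sub_res hs0 hr, norm_smul, Real.norm_eq_abs]
    gcongr
    refine (S.norm_res_le hs0 _).trans ?_
    gcongr
    exact S.norm_res_le hr x
  have h0 : Tendsto (fun s : ℝ => |r - s| * ((r / 2)⁻¹ * (r⁻¹ * ‖x‖))) (𝓝 r) (𝓝 0) := by
    have : Continuous fun s : ℝ => |r - s| * ((r / 2)⁻¹ * (r⁻¹ * ‖x‖)) := by fun_prop
    simpa using this.tendsto r
  have := squeeze_zero_norm' hev h0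
  exact tendsto_sub_nhds_zero_iff.1 this

end ContractionSemigroup

/-! ### A weighted Hardy inequality for the kernel u^{-1/2}. -/

section WeightedHardy

open Set
open scoped ENNReal

/-- The kernel `u ^ (-1/2)` of the half-order fractional integral, extended by zero. -/
noncomputable def invSqrtKernel : ℝ → ℝ≥0∞ :=
  (Ioi 0).indicator fun u => ENNReal.ofReal (u ^ (-(1 / 2) : ℝ))

theorem measurable_invSqrtKernel : Measurable invSqrtKernel :=
  Measurable.indicator (by fun_prop) measurableSet_Ioi

theorem invSqrtKernel_of_pos {u : ℝ} (hu : 0 < u) :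
    invSqrtKernel u = ENNReal.ofReal (u ^ (-(1 / 2) : ℝ)) :=
  indicator_of_mem (mem_Ioi.2 hu) _

theorem invSqrtKernel_of_nonpos {u : ℝ} (hu : u ≤ 0) : invSqrtKernel u = 0 :=
  indicator_of_notMem (by simpa using hu) _

theorem lintegral_Ioc_rpow_neg_half {a : ℝ} (ha : 0 ≤ a) :
    ∫⁻ u in Ioc 0 a, ENNReal.ofReal (u ^ (-(1 / 2) : ℝ)) =
      ENNReal.ofReal (2 * a ^ (1 / 2 : ℝ)) := by
  have hi : IntervalIntegrable (fun u : ℝ => u ^ (-(1 / 2) : ℝ)) volume 0 a :=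
    intervalIntegral.intervalIntegrable_rpow' (by norm_num)
  rw [← ofReal_integral_eq_lintegral_ofReal
    ((intervalIntegrable_iff_integrableOn_Ioc_of_le ha).1 hi),
    ← intervalIntegral.integral_of_le ha, integral_rpow (Or.inl (by norm_num))]
  · congr 1
    rw [Real.zero_rpow (by norm_num)]
    norm_num
    ring
  · filter_upwards [ae_restrict_mem measurableSet_Ioc] with u hu
    exact Real.rpow_nonneg hu.1.le _

theorem lintegral_Ioi_rpow_neg_three_half {a : ℝ} (ha : 0 < a) :
    ∫⁻ u in Ioi a, ENNReal.ofReal (u ^ (-(3 / 2) : ℝ)) =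
      ENNReal.ofReal (2 * a ^ (-(1 / 2) : ℝ)) := by
  rw [← ofReal_integral_eq_lintegral_ofReal (integrableOn_Ioi_rpow_of_lt (by norm_num) ha),
    integral_Ioi_rpow_of_lt (by norm_num) ha]
  · congr 1
    norm_num
    ring
  · filter_upwards [ae_restrict_mem measurableSet_Ioi] with u hu
    exact Real.rpow_nonneg (ha.trans hu).le _

/-- The exact value is π t^{-1/2}. Bounding 1/(t + u) by 1/t for u ≤ t and by 1/u for u > t gives 2
t^{-1/2} from each half. -/
theorem lintegral_invSqrtKernel_mul_inv_le {t : ℝ} (ht : 0 < t) :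
    ∫⁻ u, invSqrtKernel u * ENNReal.ofReal (t + u)⁻¹ ≤
      4 * invSqrtKernel t := by
  have hpt : ∀ u, invSqrtKernel u * ENNReal.ofReal (t + u)⁻¹ ≤
      (Ioc 0 t).indicator (fun u => ENNReal.ofReal t⁻¹ * ENNReal.ofReal (u ^ (-(1 / 2) : ℝ))) u +
      (Ioi t).indicator (fun u => ENNReal.ofReal (u ^ (-(3 / 2) : ℝ))) u := by
    intro u
    rcases le_or_gt u 0 with hu | hu
    · simp [invSqrtKernel_of_nonpos hu]
    rw [invSqrtKernel_of_pos hu]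
    rcases le_or_gt u t with hut | hut
    · rw [indicator_of_mem (show u ∈ Ioc 0 t from ⟨hu, hut⟩), mul_comm]
      refine le_add_right ?_
      gcongr
      linarith
    · rw [indicator_of_mem (show u ∈ Ioi t from hut)]
      refine le_add_left ?_
      rw [← ENNReal.ofReal_mul (by positivity)]
      refine ENNReal.ofReal_le_ofReal ?_
      rw [show (-(3 / 2) : ℝ) = -(1 / 2) + -1 by norm_num, Real.rpow_add hu, Real.rpow_neg_one]
      gcongr
      linarith
  refine (lintegral_mono hpt).trans ?_
  rw [lintegral_add_left (Measurable.indicator (by fun_prop) measurableSet_Ioc),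
    lintegral_indicator measurableSet_Ioc, lintegral_indicator measurableSet_Ioi,
    lintegral_const_mul _ (by fun_prop), lintegral_Ioc_rpow_neg_half ht.le,
    lintegral_Ioi_rpow_neg_three_half ht, invSqrtKernel_of_pos ht,
    ← ENNReal.ofReal_mul (by positivity), ← ENNReal.ofReal_add (by positivity) (by positivity),
    show (4 : ℝ≥0∞) = ENNReal.ofReal 4 by simp, ← ENNReal.ofReal_mul (by norm_num)]
  refine ENNReal.ofReal_le_ofReal (le_of_eq ?_)
  have : t ^ (1 / 2 : ℝ) = t * t ^ (-(1 / 2) : ℝ) := by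
    nth_rw 2 [← Real.rpow_one t]
    rw [← Real.rpow_add ht]
    norm_num
  rw [this]
  field_simp
  norm_num

/-- This is the Beta integral B(1/2, 1/2) = π. The symmetry t ↔ v - t reduces it to t ≤ v/2, where
the second factor is at most (v/2)^{-1/2}; being independent of v, the bound is what makes the Schur
test close. -/
theorem lintegral_invSqrtKernel_mul_invSqrtKernel_sub_le {v : ℝ} (hv : 0 < v) :
    ∫⁻ t, invSqrtKernel t * invSqrtKernel (v - t) ≤ 4 := by
  set c := ENNReal.ofReal ((v / 2) ^ (-(1 / 2) : ℝ)) with hc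
  set φ : ℝ → ℝ≥0∞ :=
    (Ioc 0 (v / 2)).indicator fun u => ENNReal.ofReal (u ^ (-(1 / 2) : ℝ)) with hφ
  have hφm : Measurable φ := Measurable.indicator (by fun_prop) measurableSet_Ioc
  have hpt : ∀ t, invSqrtKernel t * invSqrtKernel (v - t) ≤ c * (φ t + φ (v - t)) := by
    have key : ∀ t, 0 < t → t ≤ v / 2 →
        invSqrtKernel t * invSqrtKernel (v - t) ≤ c * φ t := by
      intro t ht ht2
      rw [invSqrtKernel_of_pos ht, invSqrtKernel_of_pos (by linarith), hφ,
        indicator_of_mem (show t ∈ Ioc 0 (v / 2) from ⟨ht, ht2⟩), mul_comm]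
      refine mul_le_mul_left (ENNReal.ofReal_le_ofReal ?_) _
      exact Real.rpow_le_rpow_of_nonpos (by positivity) (by linarith) (by norm_num)
    intro t
    rcases le_or_gt t 0 with ht | ht
    · simp [invSqrtKernel_of_nonpos ht]
    rcases le_or_gt v t with htv | htv
    · simp [invSqrtKernel_of_nonpos (sub_nonpos.2 htv)]
    rcases le_total t (v / 2) with h | h
    · refine (key t ht h).trans ?_
      gcongr
      exact le_self_add
    · have := key (v - t) (by linarith) (by linarith)
      rw [sub_sub_cancel, mul_comm] at this
      refine this.trans ?_
      gcongr
      exact le_add_self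
  refine (lintegral_mono hpt).trans ?_
  rw [lintegral_const_mul _ (by fun_prop), lintegral_add_left hφm,
    lintegral_sub_left_eq_self φ v, hφ, lintegral_indicator measurableSet_Ioc,
    lintegral_Ioc_rpow_neg_half (by positivity), hc, ← ENNReal.ofReal_add (by positivity)
    (by positivity), ← ENNReal.ofReal_mul (by positivity),
    show (4 : ℝ≥0∞) = ENNReal.ofReal 4 by simp]
  refine ENNReal.ofReal_le_ofReal (le_of_eq ?_)
  have : (v / 2) ^ (-(1 / 2) : ℝ) * (v / 2) ^ (1 / 2 : ℝ) = 1 := by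
    rw [← Real.rpow_add (by positivity)]
    norm_num
  linear_combination 4 * this

theorem sq_lintegral_mul_le {α : Type*} [MeasurableSpace α] (μ : Measure α) {f g : α → ℝ≥0∞}
    (hf : Measurable f) (hg : Measurable g) :
    (∫⁻ a, f a * g a ∂μ) ^ 2 ≤ (∫⁻ a, f a ^ 2 ∂μ) * ∫⁻ a, g a ^ 2 ∂μ := by
  have h := ENNReal.lintegral_mul_le_Lp_mul_Lq μ Real.HolderConjugate.two_two
    hf.aemeasurable hg.aemeasurable
  have hsq : ∀ a : ℝ≥0∞, (a ^ (1 / 2 : ℝ)) ^ 2 = a := fun a => by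
    rw [← ENNReal.rpow_natCast, ← ENNReal.rpow_mul]; norm_num
  have h2 := pow_le_pow_left₀ zero_le h 2
  simp only [mul_pow, hsq, ENNReal.rpow_two, Pi.mul_apply] at h2
  exact h2

/-- A weighted Hardy inequality for the half-order fractional integral. -/
theorem lintegral_sq_halfIntegral_le {H : ℝ → ℝ≥0∞} (hH : Measurable H) :
    ∫⁻ t in Ioi (0 : ℝ), (∫⁻ u, invSqrtKernel u * H (t + u)) ^ 2 ≤
      16 * ∫⁻ u in Ioi (0 : ℝ), ENNReal.ofReal u * H u ^ 2 := by
  have hk := measurable_invSqrtKernel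
  set G : ℝ → ℝ≥0∞ := (Ioi 0).indicator fun v => ENNReal.ofReal v * H v ^ 2 with hG
  have hGm : Measurable G := Measurable.indicator (by fun_prop) measurableSet_Ioi
  have hsq : ∀ a : ℝ≥0∞, (a ^ (1 / 2 : ℝ)) ^ 2 = a := fun a => by
    rw [← ENNReal.rpow_natCast, ← ENNReal.rpow_mul]; norm_num
  have h1 : ∀ t ∈ Ioi (0 : ℝ), (∫⁻ u, invSqrtKernel u * H (t + u)) ^ 2 ≤
      4 * (invSqrtKernel t * ∫⁻ v, invSqrtKernel (v - t) * G v) := by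
    intro t ht
    have ht : 0 < t := ht
    -- Schur test: the weight t + u is moved from one Cauchy-Schwarz factor to the other, so that it
    -- ends up on H² as the weight of the right-hand side.
    have hcs := sq_lintegral_mul_le volume
      (f := fun u => (invSqrtKernel u * ENNReal.ofReal (t + u)⁻¹) ^ (1 / 2 : ℝ))
      (g := fun u => (invSqrtKernel u * G (t + u)) ^ (1 / 2 : ℝ))
      (by fun_prop) (by fun_prop)
    simp only [hsq] at hcs
    have e1 : ∀ u, (invSqrtKernel u * ENNReal.ofReal (t + u)⁻¹) ^ (1 / 2 : ℝ) *
        (invSqrtKernel u * G (t + u)) ^ (1 / 2 : ℝ) = invSqrtKernel u * H (t + u) := by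
      intro u
      rcases le_or_gt u 0 with hu | hu
      · simp [invSqrtKernel_of_nonpos hu]
      have htu : 0 < t + u := by linarith
      rw [hG, indicator_of_mem (mem_Ioi.2 htu), ← ENNReal.mul_rpow_of_nonneg _ _ (by norm_num)]
      have e2 : invSqrtKernel u * ENNReal.ofReal (t + u)⁻¹ *
          (invSqrtKernel u * (ENNReal.ofReal (t + u) * H (t + u) ^ 2)) =
          (invSqrtKernel u * H (t + u)) ^ 2 * (ENNReal.ofReal (t + u)⁻¹ * ENNReal.ofReal (t + u)) := by
        ring
      rw [e2, ← ENNReal.ofReal_mul (by positivity), inv_mul_cancel₀ htu.ne', ENNReal.ofReal_one,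
        mul_one, ← ENNReal.rpow_natCast, ← ENNReal.rpow_mul]
      norm_num
    simp only [e1] at hcs
    refine hcs.trans ?_
    have e3 : ∫⁻ u, invSqrtKernel u * G (t + u) = ∫⁻ v, invSqrtKernel (v - t) * G v := by
      rw [← lintegral_add_left_eq_self (fun v => invSqrtKernel (v - t) * G v) t]
      simp
    rw [e3, ← mul_assoc]
    gcongr
    exact lintegral_invSqrtKernel_mul_inv_le ht
  calc ∫⁻ t in Ioi (0 : ℝ), (∫⁻ u, invSqrtKernel u * H (t + u)) ^ 2
      ≤ ∫⁻ t in Ioi (0 : ℝ), 4 * (invSqrtKernel t * ∫⁻ v, invSqrtKernel (v - t) * G v) :=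
        setLIntegral_mono' measurableSet_Ioi h1
    _ ≤ ∫⁻ t, 4 * (invSqrtKernel t * ∫⁻ v, invSqrtKernel (v - t) * G v) :=
        setLIntegral_le_lintegral _ _
    _ = 4 * ∫⁻ t, ∫⁻ v, invSqrtKernel t * invSqrtKernel (v - t) * G v := by
        rw [lintegral_const_mul' _ _ (by simp)]
        congr 1
        refine lintegral_congr fun t => ?_
        rw [← lintegral_const_mul _ (by fun_prop)]
        simp only [mul_assoc]
    _ = 4 * ∫⁻ v, ∫⁻ t, invSqrtKernel t * invSqrtKernel (v - t) * G v := by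
        rw [lintegral_lintegral_swap (by unfold Function.uncurry; fun_prop)]
    _ ≤ 4 * ∫⁻ v, 4 * G v := by
        gcongr with v
        rw [lintegral_mul_const _ (by fun_prop)]
        rcases le_or_gt v 0 with hv | hv
        · simp [hG, hv]
        · gcongr
          exact lintegral_invSqrtKernel_mul_invSqrtKernel_sub_le hv
    _ = 16 * ∫⁻ u in Ioi (0 : ℝ), ENNReal.ofReal u * H u ^ 2 := by
        rw [lintegral_const_mul _ hGm, hG, lintegral_indicator measurableSet_Ioi, ← mul_assoc]
        norm_num

end WeightedHardy

/-! ### Integrals of the increments N(u) - N(τ + u). -/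

section DecreasingIncrements

open Set

variable {N : ℝ → ℝ} {τ : ℝ}

theorem integrableOn_Ioi_comp_add (hN : IntegrableOn N (Ioi 0)) (hτ : 0 ≤ τ) :
    IntegrableOn (fun u => N (τ + u)) (Ioi 0) := by
  have h := ((measurePreserving_add_left volume τ).integrableOn_comp_preimage
    (measurableEmbedding_addLeft τ) (f := N) (s := Ioi τ)).2
    (hN.mono_set (Ioi_subset_Ioi hτ))
  rwa [show (fun u => τ + u) ⁻¹' Ioi τ = Ioi 0 by ext; simp] at h

theorem integral_Ioi_sub_comp_add (hN : IntegrableOn N (Ioi 0)) (hτ : 0 ≤ τ) :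
    ∫ u in Ioi 0, (N u - N (τ + u)) = ∫ u in (0 : ℝ)..τ, N u := by
  rw [integral_sub hN (integrableOn_Ioi_comp_add hN hτ), integral_Ioi_comp_add_left, add_zero,
    ← intervalIntegral.integral_interval_add_Ioi hN (hN.mono_set (Ioi_subset_Ioi hτ)),
    add_sub_cancel_right]

theorem integrableOn_Ioi_mul_sub_comp_add (hN : IntegrableOn N (Ioi 0))
    (hN' : IntegrableOn (fun u => u * N u) (Ioi 0)) (hτ : 0 ≤ τ) :
    IntegrableOn (fun u => u * (N u - N (τ + u))) (Ioi 0) := by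
  have h := (hN'.sub (integrableOn_Ioi_comp_add hN' hτ)).add
    ((integrableOn_Ioi_comp_add hN hτ).const_mul τ)
  refine h.congr_fun (fun u _ => ?_) measurableSet_Ioi
  simp only [Pi.add_apply, Pi.sub_apply]
  ring

/-- A discrete form of ∫ u (-N'(u)) du = ∫ N. The differences u N(u) - (τ + u) N(τ + u) telescope to
an integral over [0, τ], where u ≤ τ, and the remainder is τ times the integral of N over (τ, ∞). -/
theorem integral_Ioi_mul_sub_comp_add_le (hN : IntegrableOn N (Ioi 0))
    (hN' : IntegrableOn (fun u => u * N u) (Ioi 0)) (hτ : 0 ≤ τ) (h0 : ∀ u, 0 ≤ N u) :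
    ∫ u in Ioi 0, u * (N u - N (τ + u)) ≤ τ * ∫ u in Ioi 0, N u := by
  have hsh := integrableOn_Ioi_comp_add hN hτ
  have hsh' := integrableOn_Ioi_comp_add hN' hτ
  have e : ∫ u in Ioi 0, u * (N u - N (τ + u)) =
      ∫ u in Ioi 0, ((u * N u - (τ + u) * N (τ + u)) + τ * N (τ + u)) := by
    congr 1
    ext u
    ring
  rw [e, integral_add (f := fun u => u * N u - (τ + u) * N (τ + u)) (hN'.sub hsh')
    (hsh.const_mul τ), integral_const_mul, integral_Ioi_sub_comp_add hN' hτ, integral_Ioi_comp_add_left, add_zero,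
    ← intervalIntegral.integral_interval_add_Ioi hN (hN.mono_set (Ioi_subset_Ioi hτ)), mul_add]
  gcongr
  rw [← intervalIntegral.integral_const_mul]
  have hii : ∀ {f : ℝ → ℝ}, IntegrableOn f (Ioi 0) → IntervalIntegrable f volume 0 τ := fun hf =>
    (intervalIntegrable_iff_integrableOn_Ioc_of_le hτ).2 (hf.mono_set Ioc_subset_Ioi_self)
  refine intervalIntegral.integral_mono_on hτ (hii hN') ((hii hN).const_mul τ) fun u hu => ?_
  exact mul_le_mul_of_nonneg_right hu.2 (h0 u)

end DecreasingIncrements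

/-- The defect operator of a contraction. -/
theorem exists_norm_sq_eq_norm_sq_sub {X : Type*} [NormedAddCommGroup X] [InnerProductSpace ℂ X]
    [CompleteSpace X] (V : X →L[ℂ] X) (hV : ∀ x, ‖V x‖ ≤ ‖x‖) :
    ∃ D : X →L[ℂ] X, ∀ x, ‖D x‖ ^ 2 = ‖x‖ ^ 2 - ‖V x‖ ^ 2 := by
  have key : ∀ (W : X →L[ℂ] X) x, inner ℂ ((star W * W) x) x = ((‖W x‖ ^ 2 : ℝ) : ℂ) := by
    intro W x
    rw [ContinuousLinearMap.star_eq_adjoint, mul_apply_eq_comp,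
      ContinuousLinearMap.adjoint_inner_left, inner_self_eq_norm_sq_to_K]
    push_cast
    rfl
  have hone : ∀ x : X, inner ℂ ((1 - star V * V) x) x = ((‖x‖ ^ 2 - ‖V x‖ ^ 2 : ℝ) : ℂ) := by
    intro x
    rw [sub_apply, inner_sub_left, key, one_apply_eq_self,
      inner_self_eq_norm_sq_to_K]
    push_cast
    rfl
  have hpos : 0 ≤ 1 - star V * V := by
    rw [ContinuousLinearMap.nonneg_iff_isPositive, ContinuousLinearMap.isPositive_iff_complex]
    intro x
    have h := hone x
    refine ⟨?_, ?_⟩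
    · rw [h]
      simp only [RCLike.re_eq_complex_re, Complex.ofReal_re]
    · rw [h]
      simp only [Complex.ofReal_re, RCLike.re_eq_complex_re]
      have := pow_le_pow_left₀ (norm_nonneg _) (hV x) 2
      linarith
  -- Any D with D* D = 1 - V* V serves; D need not be the positive square root.
  obtain ⟨D, hD⟩ := CStarAlgebra.nonneg_iff_eq_star_mul_self.1 hpos
  refine ⟨D, fun x => ?_⟩
  have h1 := hone x
  rw [hD, key] at h1
  exact_mod_cast h1

/-! ### The truncated Balakrishnan integral and its square-function estimate. -/

namespace ContractionSemigroup

open Set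
open scoped ENNReal

section Truncation

variable {X : Type*} [NormedAddCommGroup X] [NormedSpace ℂ X]
  (S : ContractionSemigroup X)

theorem norm_rpow_smul_res_le {s : ℝ} (hs : 0 < s) (y : X) :
    ‖s ^ (-(1 / 2) : ℝ) • S.res s y‖ ≤ s ^ (-(3 / 2) : ℝ) * ‖y‖ := by
  rw [norm_smul, Real.norm_of_nonneg (Real.rpow_nonneg hs.le _),
    show (-(3 / 2) : ℝ) = -(1 / 2) + -1 by norm_num, Real.rpow_add hs, Real.rpow_neg_one, mul_assoc]
  gcongr
  exact S.norm_res_le hs y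

variable [CompleteSpace X] {ε : ℝ}

theorem continuousOn_rpow_smul_res (y : X) :
    ContinuousOn (fun s : ℝ => s ^ (-(1 / 2) : ℝ) • S.res s y) (Ioi 0) :=
  have h : ContinuousOn (fun s : ℝ => s ^ (-(1 / 2) : ℝ)) (Ioi 0) := fun s hs =>
    (Real.continuousAt_rpow_const s _ (Or.inl (ne_of_gt hs))).continuousWithinAt
  h.smul (S.continuousOn_res y)

theorem integrableOn_rpow_smul_res (hε : 0 < ε) (y : X) :
    IntegrableOn (fun s : ℝ => s ^ (-(1 / 2) : ℝ) • S.res s y) (Ioi ε) := by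
  refine Integrable.mono' ((integrableOn_Ioi_rpow_of_lt (a := -(3 / 2)) (by norm_num) hε).mul_const ‖y‖)
    (((S.continuousOn_rpow_smul_res y).mono (Ioi_subset_Ioi hε.le)).aestronglyMeasurable
      measurableSet_Ioi) ?_
  filter_upwards [ae_restrict_mem measurableSet_Ioi] with s hs
  exact S.norm_rpow_smul_res_le (hε.trans hs) y

/-- The truncated Balakrishnan integral `(1/π) ∫_ε^∞ s^{-1/2} (s + B)⁻¹ ds`, for `ε > 0`. -/
noncomputable def negSqrtTrunc (ε : ℝ) : X →L[ℂ] X :=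
  if hε : 0 < ε then
    LinearMap.mkContinuous
      { toFun := fun y => Real.pi⁻¹ • ∫ s in Ioi ε, s ^ (-(1 / 2) : ℝ) • S.res s y
        map_add' := fun x y => by
          rw [← smul_add, ← integral_add (S.integrableOn_rpow_smul_res hε x)
            (S.integrableOn_rpow_smul_res hε y)]
          simp only [map_add, smul_add]
        map_smul' := fun c x => by
          rw [RingHom.id_apply, smul_comm c, ← integral_smul c]
          simp only [map_smul, smul_comm c] }
      (Real.pi⁻¹ * (-ε ^ (-(3 / 2) + 1 : ℝ) / (-(3 / 2) + 1 : ℝ))) (fun y => by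
        rw [LinearMap.coe_mk, AddHom.coe_mk, norm_smul,
          Real.norm_of_nonneg (inv_nonneg.2 Real.pi_pos.le), mul_assoc]
        gcongr
        rw [← integral_Ioi_rpow_of_lt (by norm_num) hε, ← integral_mul_const]
        refine norm_integral_le_of_norm_le
          ((integrableOn_Ioi_rpow_of_lt (by norm_num) hε).mul_const ‖y‖) ?_
        filter_upwards [ae_restrict_mem measurableSet_Ioi] with s hs
        exact S.norm_rpow_smul_res_le (hε.trans hs) y)
  else 0

theorem negSqrtTrunc_apply (hε : 0 < ε) (y : X) :
    S.negSqrtTrunc ε y = Real.pi⁻¹ • ∫ s in Ioi ε, s ^ (-(1 / 2) : ℝ) • S.res s y := by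
  rw [negSqrtTrunc, dif_pos hε]; rfl

theorem map_negSqrtTrunc (hε : 0 < ε) (L : X →L[ℂ] X) (y : X) :
    L (S.negSqrtTrunc ε y) =
      Real.pi⁻¹ • ∫ s in Ioi ε, s ^ (-(1 / 2) : ℝ) • L (S.res s y) := by
  have hr : ∀ (c : ℝ) x, L (c • x) = c • L x := fun c x => by
    rw [← Complex.coe_smul, map_smul, Complex.coe_smul]
  rw [S.negSqrtTrunc_apply hε, hr, ← L.integral_comp_comm (S.integrableOn_rpow_smul_res hε y)]
  simp only [hr]

theorem map_negSqrtTrunc_comm (hε : 0 < ε) (L : X →L[ℂ] X)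
    (hL : ∀ s, 0 < s → ∀ x, L (S.res s x) = S.res s (L x)) (y : X) :
    L (S.negSqrtTrunc ε y) = S.negSqrtTrunc ε (L y) := by
  rw [S.map_negSqrtTrunc hε, S.negSqrtTrunc_apply hε]
  congr 1
  refine setIntegral_congr_fun measurableSet_Ioi fun s hs => ?_
  simp only [hL s (hε.trans hs)]

/-- For s > 1 one has s^{-1/2} ≤ (s - 1)^{-1/2}, and after a translation the Gamma integral gives
Γ(1/2) u^{-1/2} with Γ(1/2) = √π. -/
theorem lintegral_rpow_mul_exp_le {u : ℝ} (hu : 0 < u) :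
    ∫⁻ s in Ioi (1 : ℝ), ENNReal.ofReal (s ^ (-(1 / 2) : ℝ)) *
      ENNReal.ofReal (Real.exp (-(s - 1) * u)) ≤ ENNReal.ofReal (√Real.pi) * invSqrtKernel u := by
  set g : ℝ → ℝ := fun s => s ^ ((1 / 2 : ℝ) - 1) * Real.exp (-(u * s)) with hg
  have h1 : ∫⁻ s in Ioi (1 : ℝ), ENNReal.ofReal (g (-1 + s)) =
      ∫⁻ s in Ioi (0 : ℝ), ENNReal.ofReal (g s) := by
    have h := (measurePreserving_add_left volume (-1 : ℝ)).setLIntegral_comp_preimage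
      (measurableSet_Ioi (a := (0 : ℝ))) (f := fun s => ENNReal.ofReal (g s)) (by fun_prop)
    rwa [show (fun s : ℝ => -1 + s) ⁻¹' Ioi 0 = Ioi 1 by ext s; simp] at h
  -- A non-integrable function would have integral 0 by convention, against the positive value of
  -- the Gamma formula.
  have hgi : IntegrableOn g (Ioi 0) := by
    by_contra hcon
    have h2 := Real.integral_rpow_mul_exp_neg_mul_Ioi (a := 1 / 2) (by norm_num) hu
    have h3 : ∫ s in Ioi (0 : ℝ), g s = 0 := integral_undef hcon
    have h4 : 0 < (1 / u) ^ (1 / 2 : ℝ) * Real.Gamma (1 / 2) :=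
      mul_pos (by positivity) (Real.Gamma_pos_of_pos (by norm_num))
    rw [← h2] at h4
    exact h4.ne' h3
  calc _ ≤ ∫⁻ s in Ioi (1 : ℝ), ENNReal.ofReal (g (-1 + s)) := by
        refine setLIntegral_mono' measurableSet_Ioi fun s hs => ?_
        have hs : 1 < s := hs
        rw [← ENNReal.ofReal_mul (Real.rpow_nonneg (by linarith) _)]
        refine ENNReal.ofReal_le_ofReal ?_
        simp only [hg]
        rw [show -(s - 1) * u = -(u * (-1 + s)) by ring]
        gcongr
        rw [show ((1 / 2 : ℝ) - 1) = -(1 / 2) by norm_num]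
        exact Real.rpow_le_rpow_of_nonpos (by linarith) (by linarith) (by norm_num)
    _ = ENNReal.ofReal (√Real.pi) * invSqrtKernel u := by
        rw [h1, ← ofReal_integral_eq_lintegral_ofReal hgi,
          Real.integral_rpow_mul_exp_neg_mul_Ioi (by norm_num) hu, Real.Gamma_one_half_eq,
          invSqrtKernel_of_pos hu, ← ENNReal.ofReal_mul (by positivity), mul_comm]
        · rw [one_div u, Real.inv_rpow hu.le, Real.rpow_neg hu.le]
        · filter_upwards [ae_restrict_mem measurableSet_Ioi] with s hs
          have : 0 ≤ s := le_of_lt hs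
          positivity

/-- A pointwise bound of the resolvent average by a half-order fractional integral of the damped
orbit. -/
theorem enorm_map_op_negSqrtTrunc_one_le (D : X →L[ℂ] X) {t : ℝ} (ht : 0 ≤ t) (y : X) :
    ‖D (Real.exp (-t) • S.op t (S.negSqrtTrunc 1 y))‖ₑ ≤ ENNReal.ofReal (√Real.pi)⁻¹ *
      ∫⁻ u, invSqrtKernel u * ‖D (Real.exp (-(t + u)) • S.op (t + u) y)‖ₑ := by
  set H : ℝ → ℝ≥0∞ := fun u => ‖D (Real.exp (-u) • S.op u y)‖ₑ with hH
  have hHm : Measurable H := by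
    have := S.continuous_op y
    have hc : Continuous fun u => D (Real.exp (-u) • S.op u y) := by fun_prop
    exact hc.enorm.measurable
  have hk := measurable_invSqrtKernel
  have hr : ∀ (L : X →L[ℂ] X) (c : ℝ) x, L (c • x) = c • L x := fun L c x => by
    rw [← Complex.coe_smul, map_smul, Complex.coe_smul]
  set L : X →L[ℂ] X := D.comp (Real.exp (-t) • S.op t) with hL
  have hLapply : ∀ x, L x = D (Real.exp (-t) • S.op t x) := fun x => rfl
  have hres : ∀ s ∈ Ioi (1 : ℝ), ‖s ^ (-(1 / 2) : ℝ) • L (S.res s y)‖ₑ ≤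
      ∫⁻ u in Ioi (0 : ℝ), ENNReal.ofReal (s ^ (-(1 / 2) : ℝ)) *
        ENNReal.ofReal (Real.exp (-(s - 1) * u)) * H (t + u) := by
    intro s hs
    have hs0 : 0 < s := zero_lt_one.trans hs
    rw [enorm_smul, Real.enorm_of_nonneg (Real.rpow_nonneg hs0.le _), S.map_res hs0 L]
    simp only [mul_assoc]
    rw [lintegral_const_mul _ (by fun_prop)]
    gcongr
    refine (enorm_integral_le_lintegral_enorm _).trans ?_
    refine setLIntegral_mono' measurableSet_Ioi fun u hu => le_of_eq ?_
    -- Cutting at s = 1 leaves a factor e^{-u} to spare, which with e^{-t} damps the orbit at time t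
    -- + u; only e^{-(s-1)u} remains in the s-integral.
    have e : Real.exp (-s * u) • L (S.op u y) =
        Real.exp (-(s - 1) * u) • D (Real.exp (-(t + u)) • S.op (t + u) y) := by
      rw [hLapply, hr, hr, S.op_add ht (le_of_lt hu), smul_smul, smul_smul, ← Real.exp_add,
        ← Real.exp_add]
      congr 2
      ring
    rw [e, enorm_smul, Real.enorm_of_nonneg (Real.exp_nonneg _)]
  rw [← hLapply, S.map_negSqrtTrunc one_pos L, enorm_smul,
    Real.enorm_of_nonneg (inv_nonneg.2 Real.pi_pos.le)]
  have hint : ‖∫ s in Ioi (1 : ℝ), s ^ (-(1 / 2) : ℝ) • L (S.res s y)‖ₑ ≤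
      ENNReal.ofReal (√Real.pi) * ∫⁻ u, invSqrtKernel u * H (t + u) := by
    refine (enorm_integral_le_lintegral_enorm _).trans ?_
    refine (setLIntegral_mono' measurableSet_Ioi hres).trans ?_
    rw [lintegral_lintegral_swap (by unfold Function.uncurry; fun_prop),
      ← lintegral_const_mul _ (by fun_prop)]
    refine le_trans ?_ (setLIntegral_le_lintegral (Ioi 0) _)
    refine setLIntegral_mono' measurableSet_Ioi fun u hu => ?_
    rw [lintegral_mul_const _ (by fun_prop), ← mul_assoc]
    gcongr
    exact lintegral_rpow_mul_exp_le hu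
  refine (mul_le_mul_right hint _).trans (le_of_eq ?_)
  rw [← mul_assoc, ← ENNReal.ofReal_mul (by positivity)]
  congr 2
  nth_rw 1 [← Real.mul_self_sqrt Real.pi_pos.le]
  have : 0 < √Real.pi := Real.sqrt_pos.2 Real.pi_pos
  field_simp

end Truncation

section Hilbert

variable {X : Type*} [NormedAddCommGroup X] [InnerProductSpace ℂ X]
  (S : ContractionSemigroup X)

theorem continuous_norm_sq_damped (y : X) :
    Continuous fun t => ‖Real.exp (-t) • S.op t y‖ ^ 2 := by
  have := S.continuous_op y
  fun_prop

theorem norm_sq_damped_le (t : ℝ) (y : X) :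
    ‖Real.exp (-t) • S.op t y‖ ^ 2 ≤ Real.exp (-2 * t) * ‖y‖ ^ 2 := by
  have h := S.norm_exp_smul_op_le 1 t y
  rw [neg_one_mul] at h
  refine (pow_le_pow_left₀ (norm_nonneg _) h 2).trans (le_of_eq ?_)
  rw [mul_pow, ← Real.exp_nat_mul]
  congr 2
  push_cast
  ring

theorem integrableOn_norm_sq_damped (y : X) :
    IntegrableOn (fun t => ‖Real.exp (-t) • S.op t y‖ ^ 2) (Ioi 0) := by
  refine Integrable.mono' ((exp_neg_integrableOn_Ioi 0 two_pos).mul_const (‖y‖ ^ 2))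
    (S.continuous_norm_sq_damped y).aestronglyMeasurable ?_
  refine Eventually.of_forall fun t => ?_
  rw [Real.norm_of_nonneg (by positivity)]
  exact S.norm_sq_damped_le t y

theorem integrableOn_mul_norm_sq_damped (y : X) :
    IntegrableOn (fun t => t * ‖Real.exp (-t) • S.op t y‖ ^ 2) (Ioi 0) := by
  refine Integrable.mono' ((exp_neg_integrableOn_Ioi 0 one_pos).mul_const (‖y‖ ^ 2))
    (continuous_id.mul (S.continuous_norm_sq_damped y)).aestronglyMeasurable ?_
  filter_upwards [ae_restrict_mem measurableSet_Ioi] with t ht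
  have ht : 0 < t := ht
  rw [Real.norm_of_nonneg (by positivity)]
  have h1 : t ≤ Real.exp t := by linarith [Real.add_one_le_exp t]
  calc t * ‖Real.exp (-t) • S.op t y‖ ^ 2 ≤ Real.exp t * (Real.exp (-2 * t) * ‖y‖ ^ 2) := by
        gcongr
        exact S.norm_sq_damped_le t y
    _ = Real.exp (-1 * t) * ‖y‖ ^ 2 := by
        rw [← mul_assoc, ← Real.exp_add]
        congr 2
        ring

theorem norm_sq_op_one_le (y : X) : ‖S.op 1 y‖ ^ 2 ≤ ∫ t in (0 : ℝ)..1, ‖S.op t y‖ ^ 2 := by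
  have h : ∫ _ in (0 : ℝ)..1, ‖S.op 1 y‖ ^ 2 ≤ ∫ t in (0 : ℝ)..1, ‖S.op t y‖ ^ 2 := by
    refine intervalIntegral.integral_mono_on zero_le_one (by simp)
      (((S.continuous_op y).norm.pow 2).intervalIntegrable _ _) fun t ht => ?_
    gcongr
    exact S.norm_op_anti ht.1 ht.2 y
  simpa using h

/-- Contractivity lets ‖S(1) y‖ dominate the orbit after time 1 while being dominated by the orbit
before it, so the infinite horizon costs only a factor 2. -/
theorem integral_norm_sq_damped_le (y : X) :
    ∫ t in Ioi (0 : ℝ), ‖Real.exp (-t) • S.op t y‖ ^ 2 ≤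
      2 * ∫ t in (0 : ℝ)..1, ‖S.op t y‖ ^ 2 := by
  have hi := S.integrableOn_norm_sq_damped y
  have hi1 := hi.mono_set (Ioi_subset_Ioi zero_le_one)
  have hn : ∀ t, ‖Real.exp (-t) • S.op t y‖ ^ 2 = Real.exp (-2 * t) * ‖S.op t y‖ ^ 2 := by
    intro t
    rw [norm_smul, Real.norm_of_nonneg (Real.exp_nonneg _), mul_pow, ← Real.exp_nat_mul]
    congr 2
    push_cast
    ring
  rw [← intervalIntegral.integral_interval_add_Ioi hi hi1, two_mul]
  refine add_le_add ?_ ?_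
  · refine intervalIntegral.integral_mono_on zero_le_one
      ((S.continuous_norm_sq_damped y).intervalIntegrable _ _)
      (((S.continuous_op y).norm.pow 2).intervalIntegrable _ _) fun t ht => ?_
    rw [hn]
    exact mul_le_of_le_one_left (by positivity) (Real.exp_le_one_iff.2 (by linarith [ht.1]))
  · calc ∫ t in Ioi (1 : ℝ), ‖Real.exp (-t) • S.op t y‖ ^ 2
        ≤ ∫ t in Ioi (1 : ℝ), Real.exp (-2 * t) * ‖S.op 1 y‖ ^ 2 := by
          refine setIntegral_mono_on hi1 ((exp_neg_integrableOn_Ioi 1 two_pos).mul_const _)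
            measurableSet_Ioi fun t ht => ?_
          rw [hn]
          gcongr
          exact S.norm_op_anti zero_le_one (le_of_lt ht) y
      _ ≤ ‖S.op 1 y‖ ^ 2 := by
          rw [integral_mul_const, integral_exp_mul_Ioi (by norm_num)]
          refine mul_le_of_le_one_left (by positivity) ?_
          have : Real.exp (-2 * 1) ≤ 1 := Real.exp_le_one_iff.2 (by norm_num)
          rw [neg_div_neg_eq]
          exact (div_le_one two_pos).2 (this.trans one_le_two)
      _ ≤ _ := S.norm_sq_op_one_le y

variable [CompleteSpace X]

/-- With x = R y, the defect operator converts increments of N_x and N_y into squared norms to which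
the Hardy inequality applies. The increments of N_x integrate to at least τ N_x(τ), the weighted
ones of N_y to at most τ ∫ N_y, and τ cancels. The constant is 16 from Hardy times the square of the
prefactor 1/√π. -/
theorem norm_sq_damped_negSqrtTrunc_one_le {τ : ℝ} (hτ : 0 < τ) (y : X) :
    ‖Real.exp (-τ) • S.op τ (S.negSqrtTrunc 1 y)‖ ^ 2 ≤
      16 / Real.pi * ∫ t in Ioi (0 : ℝ), ‖Real.exp (-t) • S.op t y‖ ^ 2 := by
  set x := S.negSqrtTrunc 1 y
  set N : X → ℝ → ℝ := fun z t => ‖Real.exp (-t) • S.op t z‖ ^ 2 with hN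
  have hNi : ∀ z, IntegrableOn (N z) (Ioi 0) := S.integrableOn_norm_sq_damped
  have hNi' : ∀ z, IntegrableOn (fun t => t * N z t) (Ioi 0) := S.integrableOn_mul_norm_sq_damped
  have hNc : ∀ z, Continuous (N z) := S.continuous_norm_sq_damped
  obtain ⟨D, hD⟩ := exists_norm_sq_eq_norm_sq_sub (Real.exp (-τ) • S.op τ) (fun z => by
    refine (S.norm_exp_smul_op_le 1 τ z |>.trans' (by simp)).trans ?_
    refine mul_le_of_le_one_left (norm_nonneg _) (Real.exp_le_one_iff.2 (by linarith)))
  have hDN : ∀ z t, 0 ≤ t → ‖D (Real.exp (-t) • S.op t z)‖ ^ 2 = N z t - N z (τ + t) := by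
    intro z t ht
    rw [hD]
    simp only [hN]
    congr 3
    rw [S.op_add hτ.le ht, smul_apply, ← Complex.coe_smul (Real.exp (-t)),
      map_smul, Complex.coe_smul, smul_smul, ← Real.exp_add]
    congr 2
    ring
  have hDe : ∀ z t, 0 ≤ t → ‖D (Real.exp (-t) • S.op t z)‖ₑ ^ 2 =
      ENNReal.ofReal (N z t - N z (τ + t)) := by
    intro z t ht
    rw [← hDN z t ht, ENNReal.ofReal_pow (norm_nonneg _), ofReal_norm]
  have hDnn : ∀ z t, 0 ≤ t → 0 ≤ N z t - N z (τ + t) := fun z t ht => by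
    rw [← hDN z t ht]; positivity
  have hHm : Measurable fun u => ‖D (Real.exp (-u) • S.op u y)‖ₑ := by
    have := S.continuous_op y
    have hc : Continuous fun u => D (Real.exp (-u) • S.op u y) := by fun_prop
    exact hc.enorm.measurable
  have hlow : τ * N x τ ≤ ∫ t in Ioi 0, (N x t - N x (τ + t)) := by
    rw [integral_Ioi_sub_comp_add (hNi x) hτ.le]
    have h : ∫ _ in (0 : ℝ)..τ, N x τ ≤ ∫ t in (0 : ℝ)..τ, N x t := by
      refine intervalIntegral.integral_mono_on hτ.le (by simp)
        ((hNc x).intervalIntegrable _ _) fun t ht => ?_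
      simp only [hN, norm_smul, Real.norm_of_nonneg (Real.exp_nonneg _)]
      gcongr
      · exact ht.2
      · exact S.norm_op_anti ht.1 ht.2 x
    simpa using h
  have hup := integral_Ioi_mul_sub_comp_add_le (hNi y) (hNi' y) hτ.le
    (fun u => by simp only [hN]; positivity)
  have hE : ENNReal.ofReal (∫ t in Ioi 0, (N x t - N x (τ + t))) ≤
      ENNReal.ofReal (16 / Real.pi * ∫ u in Ioi 0, u * (N y u - N y (τ + u))) := by
    rw [ENNReal.ofReal_mul (by positivity), ofReal_integral_eq_lintegral_ofReal
      (f := fun t => N x t - N x (τ + t)) ((hNi x).sub (integrableOn_Ioi_comp_add (hNi x) hτ.le)), ofReal_integral_eq_lintegral_ofReal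
      (integrableOn_Ioi_mul_sub_comp_add (hNi y) (hNi' y) hτ.le)]
    · calc ∫⁻ t in Ioi (0 : ℝ), ENNReal.ofReal (N x t - N x (τ + t))
          ≤ ∫⁻ t in Ioi (0 : ℝ), ENNReal.ofReal (√Real.pi)⁻¹ ^ 2 * (∫⁻ u, invSqrtKernel u *
              ‖D (Real.exp (-(t + u)) • S.op (t + u) y)‖ₑ) ^ 2 := by
            refine setLIntegral_mono' measurableSet_Ioi fun t ht => ?_
            rw [← hDe x t (le_of_lt ht), ← mul_pow]
            gcongr
            exact S.enorm_map_op_negSqrtTrunc_one_le D (le_of_lt ht) y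
        _ ≤ ENNReal.ofReal (√Real.pi)⁻¹ ^ 2 * (16 * ∫⁻ u in Ioi (0 : ℝ), ENNReal.ofReal u *
              ‖D (Real.exp (-u) • S.op u y)‖ₑ ^ 2) := by
            rw [lintegral_const_mul' _ _ (by simp)]
            gcongr
            exact lintegral_sq_halfIntegral_le hHm
        _ = _ := by
            rw [← mul_assoc, ← ENNReal.ofReal_pow (by positivity), inv_pow,
              Real.sq_sqrt Real.pi_pos.le, show (16 : ℝ≥0∞) = ENNReal.ofReal 16 by simp,
              ← ENNReal.ofReal_mul (by positivity), inv_mul_eq_div]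
            congr 1
            refine setLIntegral_congr_fun measurableSet_Ioi fun u hu => ?_
            simp only [hDe y u (le_of_lt hu)]
            rw [← ENNReal.ofReal_mul (le_of_lt hu)]
    · filter_upwards [ae_restrict_mem measurableSet_Ioi] with u hu
      exact mul_nonneg (le_of_lt hu) (hDnn y u (le_of_lt hu))
    · filter_upwards [ae_restrict_mem measurableSet_Ioi] with u hu
      exact hDnn x u (le_of_lt hu)
  have hnn : 0 ≤ ∫ u in Ioi 0, u * (N y u - N y (τ + u)) :=
    setIntegral_nonneg measurableSet_Ioi fun u hu =>
      mul_nonneg (le_of_lt hu) (hDnn y u (le_of_lt hu))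
  rw [ENNReal.ofReal_le_ofReal_iff (by positivity)] at hE
  have hfin : τ * N x τ ≤ τ * (16 / Real.pi * ∫ t in Ioi (0 : ℝ), N y t) :=
    calc τ * N x τ ≤ 16 / Real.pi * ∫ u in Ioi 0, u * (N y u - N y (τ + u)) := hlow.trans hE
      _ ≤ 16 / Real.pi * (τ * ∫ u in Ioi 0, N y u) := by gcongr
      _ = _ := by ring
  exact le_of_mul_le_mul_left hfin hτ

theorem norm_sq_negSqrtTrunc_one_le (y : X) :
    ‖S.negSqrtTrunc 1 y‖ ^ 2 ≤
      16 / Real.pi * ∫ t in Ioi (0 : ℝ), ‖Real.exp (-t) • S.op t y‖ ^ 2 := by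
  have h := ((S.continuous_norm_sq_damped (S.negSqrtTrunc 1 y)).tendsto 0).mono_left
    (nhdsWithin_le_nhds (s := Ioi 0))
  simp only [neg_zero, Real.exp_zero, one_smul, S.op_zero] at h
  refine le_of_tendsto h ?_
  filter_upwards [self_mem_nhdsWithin] with τ hτ
  exact S.norm_sq_damped_negSqrtTrunc_one_le hτ y

end Hilbert

end ContractionSemigroup

/-! ### Boundedness of B^{-1/2}, observability through B^{1/2}, and density of the range. -/

namespace ContractionSemigroup

open Set

section Banach

variable {X : Type*} [NormedAddCommGroup X] [NormedSpace ℂ X] [CompleteSpace X]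
  (S : ContractionSemigroup X) {ε : ℝ}

theorem norm_negSqrtTrunc_one_le (y : X) : ‖S.negSqrtTrunc 1 y‖ ≤ Real.pi⁻¹ * (2 * ‖y‖) := by
  rw [S.negSqrtTrunc_apply one_pos, norm_smul, Real.norm_of_nonneg (inv_nonneg.2 Real.pi_pos.le)]
  gcongr
  have hi := integrableOn_Ioi_rpow_of_lt (a := -(3 / 2)) (by norm_num) one_pos
  refine (norm_integral_le_of_norm_le (hi.mul_const ‖y‖) ?_).trans (le_of_eq ?_)
  · filter_upwards [ae_restrict_mem measurableSet_Ioi] with s hs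
    exact S.norm_rpow_smul_res_le (zero_lt_one.trans hs) y
  · rw [integral_mul_const, integral_Ioi_rpow_of_lt (by norm_num) one_pos]
    norm_num

/-- Used for L under which the resolvent stays bounded as s tends to 0, when the difference is
bounded uniformly in ε; the 2 is ∫₀¹ s^{-1/2} ds. -/
theorem norm_map_negSqrtTrunc_sub_le (hε : 0 < ε) (hε1 : ε ≤ 1) (L : X →L[ℂ] X) (y : X) {K : ℝ}
    (hK : ∀ s, 0 < s → s ≤ 1 → ‖L (S.res s y)‖ ≤ K) :
    ‖L (S.negSqrtTrunc ε y) - L (S.negSqrtTrunc 1 y)‖ ≤ Real.pi⁻¹ * (2 * K) := by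
  have hK0 : 0 ≤ K := (norm_nonneg _).trans (hK 1 one_pos le_rfl)
  have hi : ∀ {a : ℝ}, 0 < a →
      IntegrableOn (fun s : ℝ => s ^ (-(1 / 2) : ℝ) • L (S.res s y)) (Ioi a) := by
    intro a ha
    have h := L.integrable_comp (S.integrableOn_rpow_smul_res ha y)
    refine h.congr (Eventually.of_forall fun s => ?_)
    simp only
    rw [← Complex.coe_smul, map_smul, Complex.coe_smul]
  rw [S.map_negSqrtTrunc hε, S.map_negSqrtTrunc one_pos, ← smul_sub, norm_smul,
    Real.norm_of_nonneg (inv_nonneg.2 Real.pi_pos.le),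
    ← intervalIntegral.integral_interval_add_Ioi (hi hε) (hi one_pos), add_sub_cancel_right]
  gcongr
  have hii : ∀ a b : ℝ, IntervalIntegrable (fun s : ℝ => s ^ (-(1 / 2) : ℝ) * K) volume a b :=
    fun a b => (intervalIntegral.intervalIntegrable_rpow' (by norm_num)).mul_const K
  refine (intervalIntegral.norm_integral_le_of_norm_le hε1 (Eventually.of_forall fun s hs => ?_)
    (hii _ _)).trans ?_
  · have hs0 : 0 < s := hε.trans hs.1
    rw [norm_smul, Real.norm_of_nonneg (Real.rpow_nonneg hs0.le _)]
    gcongr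
    exact hK s hs0 hs.2
  · rw [intervalIntegral.integral_mul_const, integral_rpow (Or.inl (by norm_num))]
    gcongr
    have : 0 ≤ ε ^ (-(1 / 2) + 1 : ℝ) := by positivity
    rw [Real.one_rpow, div_le_iff₀ (by norm_num)]
    linarith

/-- The argument B (1 + B)⁻¹ y lies in the range of B, so applying (s + B)⁻¹ to it gives (1 + B)⁻¹ y
- s (s + B)⁻¹ (1 + B)⁻¹ y, bounded uniformly in s. -/
theorem norm_negSqrtTrunc_sub_res_one_le (hε : 0 < ε) (hε1 : ε ≤ 1) (y : X) :
    ‖S.negSqrtTrunc ε (y - S.res 1 y)‖ ≤ 8 * Real.pi⁻¹ * ‖y‖ := by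
  have hJ : ‖S.res 1 y‖ ≤ ‖y‖ := by simpa using S.norm_res_le one_pos y
  have h1 := S.norm_map_negSqrtTrunc_sub_le hε hε1 (ContinuousLinearMap.id ℂ X) (y - S.res 1 y)
    (K := 2 * ‖y‖) (fun s hs hs1 => ?_)
  · simp only [ContinuousLinearMap.id_apply] at h1
    have h2 := S.norm_negSqrtTrunc_one_le (y - S.res 1 y)
    have h3 : ‖y - S.res 1 y‖ ≤ 2 * ‖y‖ := (norm_sub_le _ _).trans (by linarith)
    have h4 := norm_le_norm_sub_add (S.negSqrtTrunc ε (y - S.res 1 y))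
      (S.negSqrtTrunc 1 (y - S.res 1 y))
    have h5 : Real.pi⁻¹ * (2 * ‖y - S.res 1 y‖) ≤ Real.pi⁻¹ * (2 * (2 * ‖y‖)) := by gcongr
    linarith
  · have e : S.res s (y - S.res 1 y) = S.res 1 y - s • S.res s (S.res 1 y) := by
      have h := S.res_sub_res hs one_pos y
      rw [sub_smul, one_smul, sub_eq_iff_eq_add] at h
      rw [map_sub, h]
      abel
    rw [ContinuousLinearMap.id_apply, e]
    exact (S.norm_sub_smul_res_le hs _).trans (by linarith)

/-- Integrating the orbit derivative, the left-hand vector is the integral over [0, 1] of B (s +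
B)⁻¹ S(r) y. -/
theorem norm_sub_op_one_res_le {s : ℝ} (hs : 0 < s) (y : X) :
    ‖S.res s y - S.op 1 (S.res s y)‖ ≤ 2 * ∫ r in (0 : ℝ)..1, ‖S.op r y‖ := by
  rw [(S.hasGen_res hs y).sub_op_eq_integral zero_le_one, ← intervalIntegral.integral_const_mul]
  refine intervalIntegral.norm_integral_le_of_norm_le zero_le_one
    (Eventually.of_forall fun r hr => ?_)
    (((S.continuous_op y).norm.const_mul 2).intervalIntegrable _ _)
  rw [map_sub, ← Complex.coe_smul, map_smul, Complex.coe_smul, ← S.res_op hs hr.1.le]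
  exact S.norm_sub_smul_res_le hs _

/-- `y` belongs to the domain of `B^{-1/2}`, where `-B` generates `S`, and `B^{-1/2} y = z`. -/
def HasNegSqrt (y z : X) : Prop :=
  Tendsto (fun ε => S.negSqrtTrunc ε y) (𝓝[>] 0) (𝓝 z)

variable {S} in
theorem HasNegSqrt.map {y z : X} (h : S.HasNegSqrt y z) (L : X →L[ℂ] X)
    (hL : ∀ s, 0 < s → ∀ x, L (S.res s x) = S.res s (L x)) : S.HasNegSqrt (L y) (L z) := by
  refine ((L.continuous.tendsto _).comp h).congr' ?_
  filter_upwards [self_mem_nhdsWithin] with ε hε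
  exact S.map_negSqrtTrunc_comm hε L hL y

variable {S} in
theorem HasNegSqrt.op {y z : X} (h : S.HasNegSqrt y z) {t : ℝ} (ht : 0 ≤ t) :
    S.HasNegSqrt (S.op t y) (S.op t z) :=
  h.map (S.op t) fun _ hs x => (S.res_op hs ht x).symm

variable {S} in
theorem HasNegSqrt.res {y z : X} (h : S.HasNegSqrt y z) {r : ℝ} (hr : 0 < r) :
    S.HasNegSqrt (S.res r y) (S.res r z) :=
  h.map (S.res r) fun _ hs x => S.res_comm hr hs x

/-- If `B^{-1/2}` is defined on `D(B)`, then it is bounded. -/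
theorem exists_norm_le_of_hasNegSqrt (h : ∀ x, ∃ z, S.HasNegSqrt (S.res 1 x) z) :
    ∃ M : ℝ, 0 ≤ M ∧ ∀ y z, S.HasNegSqrt y z → ‖z‖ ≤ M * ‖y‖ := by
  set e : ℕ → ℝ := fun n => 1 / ((n : ℝ) + 1) with he
  have he0 : ∀ n, 0 < e n := fun n => by positivity
  have he1 : ∀ n, e n ≤ 1 := fun n => by
    rw [he]
    exact (div_le_one (by positivity)).2 (by linarith [(Nat.cast_nonneg n : (0 : ℝ) ≤ n)])
  have het : Tendsto e atTop (𝓝[>] 0) :=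
    tendsto_nhdsWithin_iff.2 ⟨tendsto_one_div_add_atTop_nhds_zero_nat, Eventually.of_forall he0⟩
  -- Composition with (1 + B)⁻¹ makes the truncations pointwise convergent on the whole space; the
  -- complementary piece y - (1 + B)⁻¹ y is bounded directly.
  obtain ⟨M, hM⟩ := banach_steinhaus (g := fun n => (S.negSqrtTrunc (e n)).comp (S.res 1))
    (fun x => by
      obtain ⟨z, hz⟩ := h x
      obtain ⟨c, hc⟩ := (Metric.isBounded_range_of_tendsto _ (hz.comp het)).exists_norm_le
      exact ⟨c, fun n => hc _ (mem_range_self n)⟩)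
  have hM0 : 0 ≤ M := (norm_nonneg _).trans (hM 0)
  refine ⟨M + 8 * Real.pi⁻¹, by positivity, fun y z hz => ?_⟩
  refine le_of_tendsto (hz.comp het).norm (Eventually.of_forall fun n => ?_)
  have h1 : ‖S.negSqrtTrunc (e n) (S.res 1 y)‖ ≤ M * ‖y‖ :=
    ((S.negSqrtTrunc (e n)).comp (S.res 1)).le_of_opNorm_le (hM n) y
  have h2 := S.norm_negSqrtTrunc_sub_res_one_le (he0 n) (he1 n) y
  have h3 := norm_add_le (S.negSqrtTrunc (e n) (y - S.res 1 y)) (S.negSqrtTrunc (e n) (S.res 1 y))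
  rw [← map_add, sub_add_cancel] at h3
  simp only [Function.comp]
  linarith

end Banach

section Hilbert

variable {X : Type*} [NormedAddCommGroup X] [InnerProductSpace ℂ X]
  (S : ContractionSemigroup X)

theorem sq_integral_norm_op_le (y : X) :
    (∫ t in (0 : ℝ)..1, ‖S.op t y‖) ^ 2 ≤ ∫ t in (0 : ℝ)..1, ‖S.op t y‖ ^ 2 := by
  set c := ∫ t in (0 : ℝ)..1, ‖S.op t y‖ with hc
  have hcont := (S.continuous_op y).norm
  -- Nonnegativity of the variance of ‖S(t) y‖ over the unit interval.
  have h0 : 0 ≤ ∫ t in (0 : ℝ)..1, (‖S.op t y‖ ^ 2 - 2 * c * ‖S.op t y‖ + c ^ 2) :=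
    intervalIntegral.integral_nonneg zero_le_one fun t _ => by
      nlinarith [sq_nonneg (‖S.op t y‖ - c)]
  rw [intervalIntegral.integral_add (Continuous.intervalIntegrable (by fun_prop) _ _) (by simp),
    intervalIntegral.integral_sub (Continuous.intervalIntegrable (by fun_prop) _ _)
    (Continuous.intervalIntegrable (by fun_prop) _ _), intervalIntegral.integral_const_mul,
    ← hc] at h0
  simp only [intervalIntegral.integral_const, sub_zero, one_smul] at h0
  linarith

variable {S} in
theorem HasGen.re_inner_nonneg {x z : X} (h : S.HasGen x z) : 0 ≤ (inner ℂ x z).re := by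
  have h1 : Tendsto (fun t : ℝ => (inner ℂ x (t⁻¹ • (S.op t x - x))).re) (𝓝[>] 0)
      (𝓝 (inner ℂ x (-z)).re) :=
    (Complex.continuous_re.tendsto _).comp (tendsto_const_nhds.inner h)
  have h2 : (inner ℂ x (-z)).re ≤ 0 := by
    refine le_of_tendsto h1 ?_
    filter_upwards [self_mem_nhdsWithin] with t ht
    have ht : 0 < t := ht
    rw [← Complex.coe_smul, inner_smul_right, Complex.re_ofReal_mul, inner_sub_right, Complex.sub_re]
    have h3 : (inner ℂ x (S.op t x)).re ≤ ‖x‖ * ‖x‖ :=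
      (Complex.re_le_norm _).trans ((norm_inner_le_norm _ _).trans
        (mul_le_mul_of_nonneg_left (S.norm_op_le t x) (norm_nonneg _)))
    have h4 : (inner ℂ x x : ℂ).re = ‖x‖ * ‖x‖ := inner_self_eq_norm_mul_norm (𝕜 := ℂ) x
    rw [h4]
    exact mul_nonpos_of_nonneg_of_nonpos (by positivity) (by linarith)
  rw [inner_neg_right, Complex.neg_re] at h2
  linarith

variable [CompleteSpace X]

/-- Exact observability in time `1` through `B^{1/2}`. -/
theorem exists_norm_sq_le_integral_of_hasNegSqrt
    (h : ∀ x, ∃ z, S.HasNegSqrt (S.res 1 x) z) :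
    ∃ K : ℝ, 0 < K ∧ ∀ y z, S.HasNegSqrt y z →
      ‖z‖ ^ 2 ≤ K * ∫ t in (0 : ℝ)..1, ‖S.op t y‖ ^ 2 := by
  obtain ⟨M, hM0, hM⟩ := S.exists_norm_le_of_hasNegSqrt h
  set p := Real.pi⁻¹ with hp
  have hp0 : 0 < p := inv_pos.2 Real.pi_pos
  refine ⟨3 * (32 * p + (4 * p) ^ 2 + (M + 2 * p) ^ 2), by positivity, fun y z hz => ?_⟩
  set I := ∫ t in (0 : ℝ)..1, ‖S.op t y‖ ^ 2 with hI
  have ha : ‖S.negSqrtTrunc 1 y‖ ^ 2 ≤ 32 * p * I := by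
    refine (S.norm_sq_negSqrtTrunc_one_le y).trans ?_
    rw [div_eq_mul_inv]
    have := mul_le_mul_of_nonneg_left (S.integral_norm_sq_damped_le y)
      (show 0 ≤ 16 * p by positivity)
    linarith
  -- The contribution of s < 1, a limit of truncations. The resolvent bound alone cannot control it,
  -- since s^{-3/2} is not integrable at 0.
  set w := z - S.negSqrtTrunc 1 y with hw
  have hb' : ‖w - S.op 1 w‖ ≤ 4 * p * ∫ t in (0 : ℝ)..1, ‖S.op t y‖ := by
    set L : X →L[ℂ] X := ContinuousLinearMap.id ℂ X - S.op 1 with hL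
    have hLa : ∀ x, L x = x - S.op 1 x := fun x => rfl
    rw [← hLa, hw, map_sub]
    refine le_of_tendsto (((L.continuous.tendsto _).comp hz).sub_const _).norm ?_
    filter_upwards [Ioc_mem_nhdsGT (zero_lt_one (α := ℝ))] with ε hε
    refine (S.norm_map_negSqrtTrunc_sub_le hε.1 hε.2 L y
      (fun s hs _ => S.norm_sub_op_one_res_le hs y)).trans (le_of_eq ?_)
    ring
  have hb : ‖w - S.op 1 w‖ ^ 2 ≤ (4 * p) ^ 2 * I := by
    refine (pow_le_pow_left₀ (norm_nonneg _) hb' 2).trans ?_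
    rw [mul_pow]
    gcongr
    exact S.sq_integral_norm_op_le y
  have hc' : ‖S.op 1 w‖ ≤ (M + 2 * p) * ‖S.op 1 y‖ := by
    rw [hw, map_sub, S.map_negSqrtTrunc_comm one_pos (S.op 1)
      (fun s hs x => (S.res_op hs zero_le_one x).symm)]
    refine (norm_sub_le _ _).trans ?_
    have h1 := hM _ _ (hz.op zero_le_one)
    have h2 := S.norm_negSqrtTrunc_one_le (S.op 1 y)
    linarith
  have hc : ‖S.op 1 w‖ ^ 2 ≤ (M + 2 * p) ^ 2 * I := by
    refine (pow_le_pow_left₀ (norm_nonneg _) hc' 2).trans ?_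
    rw [mul_pow]
    gcongr
    exact S.norm_sq_op_one_le y
  have hz3 : ‖z‖ ≤ ‖S.negSqrtTrunc 1 y‖ + ‖w - S.op 1 w‖ + ‖S.op 1 w‖ := by
    have e : z = S.negSqrtTrunc 1 y + (w - S.op 1 w) + S.op 1 w := by rw [hw]; abel
    calc ‖z‖ = ‖S.negSqrtTrunc 1 y + (w - S.op 1 w) + S.op 1 w‖ := by rw [← e]
      _ ≤ _ := norm_add₃_le
  have hsq := pow_le_pow_left₀ (norm_nonneg z) hz3 2
  nlinarith [sq_nonneg (‖S.negSqrtTrunc 1 y‖ - ‖w - S.op 1 w‖),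
    sq_nonneg (‖S.negSqrtTrunc 1 y‖ - ‖S.op 1 w‖), sq_nonneg (‖w - S.op 1 w‖ - ‖S.op 1 w‖)]

/-- With x = (s + B)⁻¹ y one has y = s x + B x, and B is accretive. -/
theorem le_re_inner_res {s : ℝ} (hs : 0 < s) (y : X) :
    s * ‖S.res s y‖ ^ 2 ≤ (inner ℂ y (S.res s y)).re := by
  have h := (S.hasGen_res hs y).re_inner_nonneg
  have h4 : (inner ℂ (S.res s y) (S.res s y) : ℂ).re = ‖S.res s y‖ * ‖S.res s y‖ :=
    inner_self_eq_norm_mul_norm (𝕜 := ℂ) (S.res s y)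
  have h5 : (inner ℂ (S.res s y) y).re = (inner ℂ y (S.res s y)).re := inner_re_symm (𝕜 := ℂ) _ _
  rw [inner_sub_right, Complex.sub_re, ← Complex.coe_smul, inner_smul_right,
    Complex.re_ofReal_mul, h4, h5] at h
  linarith

theorem le_re_inner_res_of_mem_Icc {s : ℝ} (hs : s ∈ Icc (1 : ℝ) 2) (y : X) :
    4 / 9 * ‖S.res 2 y‖ ^ 2 ≤ s ^ (-(1 / 2) : ℝ) * (inner ℂ y (S.res s y)).re := by
  have hs0 : 0 < s := by linarith [hs.1]
  have h1 : ‖S.res 2 y‖ ≤ 3 / 2 * ‖S.res s y‖ := by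
    have h := S.res_sub_res two_pos hs0 y
    rw [sub_eq_iff_eq_add] at h
    rw [h]
    refine (norm_add_le _ _).trans ?_
    have h2 := S.norm_res_le two_pos (S.res s y)
    rw [norm_smul, Real.norm_eq_abs]
    have h3 : |s - 2| ≤ 1 := abs_le.2 ⟨by linarith [hs.1], by linarith [hs.2]⟩
    have h4 := mul_le_mul h3 h2 (norm_nonneg _) zero_le_one
    linarith
  have h2 : 1 ≤ s ^ (-(1 / 2) : ℝ) * s := by
    nth_rw 2 [← Real.rpow_one s]
    rw [← Real.rpow_add hs0]
    exact Real.one_le_rpow hs.1 (by norm_num)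
  calc 4 / 9 * ‖S.res 2 y‖ ^ 2 ≤ 4 / 9 * (3 / 2 * ‖S.res s y‖) ^ 2 := by gcongr
    _ = 1 * ‖S.res s y‖ ^ 2 := by ring
    _ ≤ s ^ (-(1 / 2) : ℝ) * s * ‖S.res s y‖ ^ 2 := by gcongr
    _ = s ^ (-(1 / 2) : ℝ) * (s * ‖S.res s y‖ ^ 2) := by ring
    _ ≤ _ := by
      gcongr
      exact S.le_re_inner_res hs0 y

variable {S} in
-- A quantitative positivity of B^{-1/2}: the integrand pairs with y to a nonnegative real part for
-- every s, so only s in [1, 2] is kept, where the resolvents are comparable with the one at 2.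
theorem HasNegSqrt.le_re_inner {y z : X} (h : S.HasNegSqrt y z) :
    Real.pi⁻¹ * (4 / 9 * ‖S.res 2 y‖ ^ 2) ≤ (inner ℂ y z).re := by
  have h1 : Tendsto (fun ε => (inner ℂ y (S.negSqrtTrunc ε y)).re) (𝓝[>] 0)
      (𝓝 (inner ℂ y z).re) :=
    (Complex.continuous_re.tendsto _).comp (tendsto_const_nhds.inner h)
  refine ge_of_tendsto h1 ?_
  filter_upwards [Ioc_mem_nhdsGT (zero_lt_one (α := ℝ))] with ε hε
  set φ : X →L[ℝ] ℝ := Complex.reCLM.comp ((innerSL ℂ y).restrictScalars ℝ) with hφ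
  have hφa : ∀ x, φ x = (inner ℂ y x).re := fun x => rfl
  have hi := S.integrableOn_rpow_smul_res hε.1 y
  rw [← hφa, S.negSqrtTrunc_apply hε.1, map_smul, ← φ.integral_comp_comm hi, smul_eq_mul]
  gcongr
  have hi' := φ.integrable_comp hi
  simp only [map_smul, smul_eq_mul] at hi' ⊢
  have hsub : Ioc (1 : ℝ) 2 ⊆ Ioi ε := fun s hs => hε.2.trans_lt hs.1
  calc 4 / 9 * ‖S.res 2 y‖ ^ 2 = ∫ _ in Ioc (1 : ℝ) 2, 4 / 9 * ‖S.res 2 y‖ ^ 2 := by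
        rw [setIntegral_const]; norm_num
    _ ≤ ∫ s in Ioc (1 : ℝ) 2, s ^ (-(1 / 2) : ℝ) * φ (S.res s y) := by
        refine setIntegral_mono_on (integrableOn_const (by simp)) (IntegrableOn.mono_set hi' hsub)
          measurableSet_Ioc fun s hs => ?_
        exact S.le_re_inner_res_of_mem_Icc ⟨hs.1.le, hs.2⟩ y
    _ ≤ _ := by
        refine setIntegral_mono_set hi' ?_ hsub.eventuallyLE
        filter_upwards [ae_restrict_mem measurableSet_Ioi] with s hs
        have hs0 : 0 < s := hε.1.trans hs
        refine mul_nonneg (Real.rpow_nonneg hs0.le _) ?_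
        exact le_trans (by positivity) (S.le_re_inner_res hs0 y)

/-- If `B^{-1/2}` is defined on the dense subspace `D(B)`, then it has dense range there. -/
theorem dense_range_negSqrt (hd : Dense (range (S.res 1)))
    (h : ∀ x, ∃ z, S.HasNegSqrt (S.res 1 x) z) :
    Dense {z | ∃ x, S.HasNegSqrt (S.res 1 x) z} := by
  obtain ⟨M, hM0, hM⟩ := S.exists_norm_le_of_hasNegSqrt h
  let E : Submodule ℂ X :=
    { carrier := {z | ∃ x, S.HasNegSqrt (S.res 1 x) z}
      add_mem' := by
        rintro a b ⟨x, hx⟩ ⟨y, hy⟩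
        exact ⟨x + y, (Tendsto.add hx hy).congr fun ε => by simp only [map_add]⟩
      zero_mem' := ⟨0, tendsto_const_nhds.congr fun ε => by simp only [map_zero]⟩
      smul_mem' := by
        rintro c a ⟨x, hx⟩
        exact ⟨c • x, (Tendsto.const_smul hx c).congr fun ε => by simp only [map_smul]⟩ }
  change Dense (E : Set X)
  rw [Submodule.dense_iff_topologicalClosure_eq_top, Submodule.topologicalClosure_eq_top_iff,
    Submodule.eq_bot_iff]
  intro w hw
  obtain ⟨y, hy, hyw⟩ := mem_closure_iff_seq_limit.1 (hd w)
  choose x hx using hy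
  choose z hz using fun n => h (x n)
  have hz' : ∀ n, S.HasNegSqrt (y n) (z n) := fun n => hx n ▸ hz n
  have horth : ∀ n, inner ℂ w (z n) = 0 := fun n =>
    (Submodule.mem_orthogonal' E w).1 hw (z n) ⟨x n, hz n⟩
  -- Since w is orthogonal to z n, the vector y n may be replaced by y n - w, which tends to 0,
  -- while `z n` is bounded through M. Positivity then forces (2 + B)⁻¹ w = 0.
  have hle : ∀ n, Real.pi⁻¹ * (4 / 9 * ‖S.res 2 (y n)‖ ^ 2) ≤ ‖y n - w‖ * (M * ‖y n‖) := by
    intro n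
    refine (hz' n).le_re_inner.trans ?_
    have : inner ℂ (y n) (z n) = inner ℂ (y n - w) (z n) := by
      rw [inner_sub_left, horth, sub_zero]
    rw [this]
    refine (Complex.re_le_norm _).trans ((norm_inner_le_norm _ _).trans ?_)
    gcongr
    exact hM _ _ (hz' n)
  have hl1 : Tendsto (fun n => Real.pi⁻¹ * (4 / 9 * ‖S.res 2 (y n)‖ ^ 2)) atTop
      (𝓝 (Real.pi⁻¹ * (4 / 9 * ‖S.res 2 w‖ ^ 2))) :=
    ((((((S.res 2).continuous.tendsto w).comp hyw).norm.pow 2).const_mul _).const_mul _)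
  have hl2 : Tendsto (fun n => ‖y n - w‖ * (M * ‖y n‖)) atTop (𝓝 (‖w - w‖ * (M * ‖w‖))) :=
    (hyw.sub_const w).norm.mul (hyw.norm.const_mul M)
  have hfin := le_of_tendsto_of_tendsto' hl1 hl2 hle
  rw [sub_self, norm_zero, zero_mul] at hfin
  have hpi : 0 < Real.pi⁻¹ := inv_pos.2 Real.pi_pos
  have h0 : S.res 2 w = 0 := by
    by_contra hne
    have : 0 < ‖S.res 2 w‖ := norm_pos_iff.2 hne
    have : 0 < Real.pi⁻¹ * (4 / 9 * ‖S.res 2 w‖ ^ 2) := by positivity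
    linarith
  have hg := S.hasGen_res two_pos w
  rw [h0, smul_zero, sub_zero] at hg
  refine hg.unique ?_
  unfold HasGen
  simp

end Hilbert

end ContractionSemigroup

theorem tendsto_inv_smul_of_hasDerivAt {E : Type*} [NormedAddCommGroup E] [NormedSpace ℝ E]
    {f : ℝ → E} {f' : E} (hf : HasDerivAt f f' 0) :
    Tendsto (fun t : ℝ => t⁻¹ • (f t - f 0)) (𝓝[>] 0) (𝓝 f') := by
  rw [hasDerivAt_iff_tendsto_slope_zero] at hf
  simp only [zero_add] at hf
  exact hf.mono_left
    (nhdsWithin_mono 0 fun t (ht : t ∈ Set.Ioi (0 : ℝ)) => (ne_of_gt ht : t ≠ 0))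

theorem tendsto_inv_smul_exp_smul_sub {E : Type*} [NormedAddCommGroup E] [NormedSpace ℝ E]
    {v : ℝ → E} {x y : E} (c : ℝ)
    (h : Tendsto (fun t : ℝ => t⁻¹ • (v t - x)) (𝓝[>] 0) (𝓝 y)) :
    Tendsto (fun t : ℝ => t⁻¹ • (Real.exp (c * t) • v t - x)) (𝓝[>] 0) (𝓝 (y + c • x)) := by
  have hd : HasDerivAt (fun t : ℝ => Real.exp (c * t)) c 0 := by
    simpa using ((hasDerivAt_id (0 : ℝ)).const_mul c).exp
  have h1 : Tendsto (fun t : ℝ => Real.exp (c * t)) (𝓝[>] 0) (𝓝 1) := by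
    have := hd.continuousAt.tendsto.mono_left (nhdsWithin_le_nhds (s := Set.Ioi 0))
    simpa using this
  have h2 := tendsto_inv_smul_of_hasDerivAt hd
  simp only [mul_zero, Real.exp_zero, smul_eq_mul] at h2
  have h3 := (h1.smul h).add (h2.smul_const x)
  rw [one_smul] at h3
  refine h3.congr fun t => ?_
  simp only [smul_sub, sub_smul, mul_sub, mul_smul, mul_one, smul_comm (Real.exp (c * t)) t⁻¹]
  abel

/-! ### From the given semigroup to its rescaled contraction semigroup. -/

namespace C0Semigroup

open Set

section Banach

variable {X : Type*} [NormedAddCommGroup X] [NormedSpace ℂ X] (T : C0Semigroup X)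

theorem continuous_op_toNNReal (x : X) : Continuous fun t : ℝ => T.op t.toNNReal x :=
  (T.strongly_continuous x).comp continuous_real_toNNReal

theorem op_toNNReal_add {s t : ℝ} (hs : 0 ≤ s) (ht : 0 ≤ t) (x : X) :
    T.op (s + t).toNNReal x = T.op s.toNNReal (T.op t.toNNReal x) := by
  rw [Real.toNNReal_add hs ht, T.op_add, ContinuousLinearMap.comp_apply]

theorem op_toNNReal_zero (x : X) : T.op (0 : ℝ).toNNReal x = x := by
  rw [Real.toNNReal_zero, T.op_zero, ContinuousLinearMap.id_apply]

theorem tendsto_diffQuot_iff {x y : X} :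
    Tendsto (T.diffQuot x) (𝓝[>] 0) (𝓝 y) ↔
      Tendsto (fun t : ℝ => t⁻¹ • (T.op t.toNNReal x - x)) (𝓝[>] 0) (𝓝 y) := by
  constructor
  · intro h
    have h1 : Tendsto Real.toNNReal (𝓝[>] 0) (𝓝[>] 0) := by
      refine tendsto_nhdsWithin_iff.2 ⟨?_, ?_⟩
      · have := (continuous_real_toNNReal.tendsto 0).mono_left (nhdsWithin_le_nhds (s := Ioi 0))
        rwa [Real.toNNReal_zero] at this
      · filter_upwards [self_mem_nhdsWithin] with t ht
        exact Real.toNNReal_pos.2 ht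
    refine (h.comp h1).congr' ?_
    filter_upwards [self_mem_nhdsWithin] with t ht
    rw [Function.comp, diffQuot, Complex.coe_smul, Real.coe_toNNReal t (le_of_lt ht)]
  · intro h
    have h1 : Tendsto (fun t : ℝ≥0 => (t : ℝ)) (𝓝[>] 0) (𝓝[>] 0) := by
      refine tendsto_nhdsWithin_iff.2 ⟨?_, ?_⟩
      · exact (NNReal.continuous_coe.tendsto 0).mono_left nhdsWithin_le_nhds
      · filter_upwards [self_mem_nhdsWithin] with t ht
        exact NNReal.coe_pos.2 ht
    refine (h.comp h1).congr fun t => ?_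
    rw [Function.comp, diffQuot, Complex.coe_smul, Real.toNNReal_coe]

variable {T} {A : X →ₗ.[ℂ] X}

theorem tendsto_of_generator_eq_neg (hA : T.generator = -A) (x : A.domain) :
    Tendsto (fun t : ℝ => t⁻¹ • (T.op t.toNNReal x - x)) (𝓝[>] 0) (𝓝 (-A x)) := by
  have h : ∀ (x : X) (hx : x ∈ T.generator.domain),
      Tendsto (T.diffQuot x) (𝓝[>] 0) (𝓝 (T.generator ⟨x, hx⟩)) := fun x hx => hx.choose_spec
  rw [hA] at h
  exact T.tendsto_diffQuot_iff.1 (h x x.2)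

theorem exists_mem_domain_of_tendsto (hA : T.generator = -A) {x z : X}
    (h : Tendsto (fun t : ℝ => t⁻¹ • (T.op t.toNNReal x - x)) (𝓝[>] 0) (𝓝 (-z))) :
    ∃ hx : x ∈ A.domain, A ⟨x, hx⟩ = z := by
  have hx : x ∈ A.domain := by
    have h1 : T.generator.domain = A.domain := by rw [hA, LinearPMap.neg_domain]
    exact h1.le ⟨_, T.tendsto_diffQuot_iff.2 h⟩
  exact ⟨hx, neg_injective (tendsto_nhds_unique (tendsto_of_generator_eq_neg hA ⟨x, hx⟩) h)⟩

theorem apply_onDomain (hA : T.generator = -A) (s : ℝ≥0) (x : A.domain) :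
    A (T.onDomain hA s x) = T.op s (A x) := by
  have h1 := tendsto_of_generator_eq_neg hA (T.onDomain hA s x)
  have h2 := ((T.op s).continuous.tendsto _).comp (tendsto_of_generator_eq_neg hA x)
  rw [map_neg] at h2
  refine neg_injective (tendsto_nhds_unique h1 (h2.congr fun t => ?_))
  have h : T.op s (T.op t.toNNReal x) = T.op t.toNNReal (T.op s x) := by
    rw [← ContinuousLinearMap.comp_apply, ← T.op_add, add_comm, T.op_add,
      ContinuousLinearMap.comp_apply]
  rw [Function.comp, ← Complex.coe_smul, map_smul, Complex.coe_smul, map_sub, h]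
  rfl

/-- The domain of the generator is dense. -/
theorem dense_domain [CompleteSpace X] (hA : T.generator = -A) : Dense (A.domain : Set X) := by
  intro x
  set f : ℝ → X := fun t => T.op t.toNNReal x with hf
  have hfc : Continuous f := T.continuous_op_toNNReal x
  have hd : ∀ b, HasDerivAt (fun t => ∫ u in (0 : ℝ)..t, f u) (f b) b := fun b =>
    intervalIntegral.integral_hasDerivAt_right (hfc.intervalIntegrable _ _)
      (hfc.stronglyMeasurableAtFilter _ _) hfc.continuousAt
  -- Time averages of an orbit lie in the domain, and short averages converge to x.
  have hmem : ∀ L, 0 ≤ L → ∫ u in (0 : ℝ)..L, f u ∈ A.domain := by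
    intro L hL
    have h1 : HasDerivAt (fun t => (∫ u in (0 : ℝ)..(t + L), f u) - ∫ u in (0 : ℝ)..t, f u)
        (f L - f 0) 0 := by
      refine HasDerivAt.sub ?_ (hd 0)
      have := hd (0 + L)
      rw [zero_add] at this
      exact HasDerivAt.comp_add_const 0 L (by rwa [zero_add])
    have h2 := tendsto_inv_smul_of_hasDerivAt h1
    refine (exists_mem_domain_of_tendsto hA (z := -(f L - f 0)) ?_).1
    rw [neg_neg]
    refine h2.congr' ?_
    filter_upwards [self_mem_nhdsWithin] with t ht
    have ht : 0 ≤ t := le_of_lt ht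
    simp only [zero_add, intervalIntegral.integral_same, sub_zero]
    congr 2
    rw [intervalIntegral.integral_interval_sub_left (hfc.intervalIntegrable _ _)
      (hfc.intervalIntegrable _ _), ← ContinuousLinearMap.intervalIntegral_comp_comm _
      (hfc.intervalIntegrable _ _)]
    have h3 := intervalIntegral.integral_comp_add_left f t (a := 0) (b := L)
    rw [add_zero] at h3
    rw [← h3]
    refine intervalIntegral.integral_congr fun u hu => ?_
    rw [uIcc_of_le hL] at hu
    exact T.op_toNNReal_add ht hu.1 x
  have hlim := tendsto_inv_smul_of_hasDerivAt (hd 0)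
  simp only [intervalIntegral.integral_same, sub_zero, hf, T.op_toNNReal_zero] at hlim
  refine mem_closure_of_tendsto hlim ?_
  filter_upwards [self_mem_nhdsWithin] with t ht
  rw [← Complex.coe_smul]
  exact A.domain.smul_mem _ (hmem t (le_of_lt ht))

theorem hasDerivWithinAt_op (hA : T.generator = -A) (x : A.domain) {t : ℝ} (ht : 0 ≤ t) :
    HasDerivWithinAt (fun r : ℝ => T.op r.toNNReal x) (-A (T.onDomain hA t.toNNReal x))
      (Ici t) t := by
  rw [← hasDerivWithinAt_Ioi_iff_Ici, hasDerivWithinAt_iff_tendsto_slope' (by simp)]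
  have h1 := tendsto_of_generator_eq_neg hA (T.onDomain hA t.toNNReal x)
  have h2 : Tendsto (fun u : ℝ => u - t) (𝓝[>] t) (𝓝[>] 0) := by
    refine tendsto_nhdsWithin_iff.2 ⟨?_, ?_⟩
    · have : Tendsto (fun u : ℝ => u - t) (𝓝 t) (𝓝 (t - t)) :=
        (continuous_id.sub continuous_const).tendsto t
      rw [sub_self] at this
      exact this.mono_left nhdsWithin_le_nhds
    · filter_upwards [self_mem_nhdsWithin] with u hu
      exact sub_pos.2 (mem_Ioi.1 hu)
  refine (h1.comp h2).congr' ?_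
  filter_upwards [self_mem_nhdsWithin] with u hu
  rw [slope_def_module]
  have h3 := T.op_toNNReal_add (sub_nonneg.2 (le_of_lt hu)) ht x
  rw [sub_add_cancel] at h3
  simp only [Function.comp, h3]
  rfl

/-- The contraction semigroup `e^{-ωt} T(t)`. -/
noncomputable def toContraction (T : C0Semigroup X) (ω : ℝ)
    (h : ∀ t, 0 ≤ t → ∀ x, ‖Real.exp (-ω * t) • T.op t.toNNReal x‖ ≤ ‖x‖) :
    ContractionSemigroup X where
  -- At negative times this is the identity, which keeps continuity and contractivity valid on the
  -- whole line.
  op t := Real.exp (-ω * max t 0) • T.op t.toNNReal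
  op_zero x := by
    rw [smul_apply, T.op_toNNReal_zero]
    simp
  op_add {s t} hs ht x := by
    rw [smul_apply, smul_apply, smul_apply, T.op_toNNReal_add hs ht, max_eq_left hs,
      max_eq_left ht, max_eq_left (add_nonneg hs ht), ← Complex.coe_smul (Real.exp (-ω * t)),
      map_smul, Complex.coe_smul, smul_smul, ← Real.exp_add]
    congr 2
    ring
  continuous_op x := by
    have := T.continuous_op_toNNReal x
    simp only [smul_apply]
    fun_prop
  norm_op_le t x := by
    have h1 := h (max t 0) (le_max_right _ _) x
    rwa [show (max t 0).toNNReal = t.toNNReal by simp [Real.toNNReal]] at h1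

variable {ω : ℝ} {h : ∀ t, 0 ≤ t → ∀ x, ‖Real.exp (-ω * t) • T.op t.toNNReal x‖ ≤ ‖x‖}

theorem toContraction_op {t : ℝ} (ht : 0 ≤ t) (x : X) :
    (T.toContraction ω h).op t x = Real.exp (-ω * t) • T.op t.toNNReal x := by
  change (Real.exp (-ω * max t 0) • T.op t.toNNReal) x = _
  rw [max_eq_left ht, smul_apply]

theorem toContraction_hasGen (hA : T.generator = -A) (x : A.domain) :
    (T.toContraction ω h).HasGen x (ω • (x : X) + A x) := by
  have h1 := tendsto_inv_smul_exp_smul_sub (-ω) (tendsto_of_generator_eq_neg hA x)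
  unfold ContractionSemigroup.HasGen
  rw [show -(ω • (x : X) + A x) = -A x + -ω • (x : X) by rw [neg_smul]; abel]
  refine h1.congr' ?_
  filter_upwards [self_mem_nhdsWithin] with t ht
  rw [toContraction_op (le_of_lt ht)]

theorem exists_mem_domain_of_hasGen (hA : T.generator = -A) {x z : X}
    (hz : (T.toContraction ω h).HasGen x z) :
    ∃ hx : x ∈ A.domain, A ⟨x, hx⟩ = z - ω • x := by
  have h1 := tendsto_inv_smul_exp_smul_sub ω hz
  refine exists_mem_domain_of_tendsto hA ?_
  rw [neg_sub, sub_eq_neg_add]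
  refine h1.congr' ?_
  filter_upwards [self_mem_nhdsWithin] with t ht
  rw [toContraction_op (le_of_lt ht), smul_smul, ← Real.exp_add]
  simp

/-- The Laplace transform inverts s + B on both sides, so the `Function.invFun` inside `invAdd` is a
genuine inverse and not a default value. -/
theorem invAdd_eq_res [CompleteSpace X] (hA : T.generator = -A) {s : ℝ} (hs : 0 < s) (x : X) :
    (A.addScalar ω).invAdd s x = (T.toContraction ω h).res s x := by
  set S := T.toContraction ω h
  have hval : ∀ z : A.domain, ((A.addScalar ω).addScalar s) z = s • (z : X) + (ω • (z : X) + A z) :=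
    fun z => rfl
  have hinj : Function.Injective
      (fun z : ((A.addScalar ω).addScalar s).domain => (A.addScalar ω).addScalar s z) := by
    intro z z' hzz
    have h1 : ∀ z : A.domain, S.res s (((A.addScalar ω).addScalar s) z) = z := fun z => by
      rw [hval]
      exact (toContraction_hasGen hA z).res_eq hs
    refine Subtype.ext ?_
    rw [← h1 z, ← h1 z']
    exact congrArg _ hzz
  obtain ⟨hx, hAx⟩ := exists_mem_domain_of_hasGen hA (S.hasGen_res hs x)
  have hfx : ((A.addScalar ω).addScalar s) (⟨S.res s x, hx⟩ : A.domain) = x := by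
    rw [hval, hAx]
    abel
  exact congrArg Subtype.val ((congrArg (Function.invFun _) hfx).symm.trans
    (Function.leftInverse_invFun hinj ⟨S.res s x, hx⟩))

theorem hasNegSqrt_iff [CompleteSpace X] (hA : T.generator = -A) {y z : X} :
    (A.addScalar ω).HasNegSqrt y z ↔ (T.toContraction ω h).HasNegSqrt y z := by
  refine tendsto_congr' ?_
  filter_upwards [self_mem_nhdsWithin] with ε hε
  rw [ContractionSemigroup.negSqrtTrunc_apply _ hε]
  congr 1
  refine setIntegral_congr_fun measurableSet_Ioi fun s hs => ?_
  simp only [invAdd_eq_res (h := h) hA (lt_trans hε hs)]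

variable {Y : Type*} [NormedAddCommGroup Y] [NormedSpace ℂ Y]

/-- Orbits starting in D(A) are continuous in the graph norm because A T(t) x = T(t) A x. -/
theorem continuous_observation (hA : T.generator = -A) {C : A.domain →ₗ[ℂ] Y}
    (hC : A.IsBoundedOnDomain C) (x : A.domain) :
    Continuous fun t : ℝ => C (T.onDomain hA t.toNNReal x) := by
  obtain ⟨M, hM⟩ := hC
  rw [continuous_iff_continuousAt]
  intro r
  refine tendsto_sub_nhds_zero_iff.1 (squeeze_zero_norm (a := fun t : ℝ =>
    M * (‖T.op t.toNNReal x - T.op r.toNNReal x‖ + ‖T.op t.toNNReal (A x) -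
      T.op r.toNNReal (A x)‖)) (fun t => ?_) ?_)
  · rw [← map_sub]
    refine (hM _).trans (le_of_eq ?_)
    rw [LinearPMap.map_sub, apply_onDomain, apply_onDomain]
    rfl
  · have h1 := T.continuous_op_toNNReal x
    have h2 := T.continuous_op_toNNReal (A x)
    have hc : Continuous fun t : ℝ => M * (‖T.op t.toNNReal x - T.op r.toNNReal x‖ +
        ‖T.op t.toNNReal (A x) - T.op r.toNNReal (A x)‖) := by fun_prop
    simpa using hc.tendsto r

end Banach

section Hilbert

variable {X : Type*} [NormedAddCommGroup X] [InnerProductSpace ℂ X]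
  {T : C0Semigroup X} {A : X →ₗ.[ℂ] X} {ω : ℝ}

/-- The right derivative of ‖S(t) x‖² is -2 Re ⟨B S(t) x, S(t) x⟩ ≤ 0. -/
theorem norm_exp_smul_op_le_of_mem_domain (hA : T.generator = -A)
    (hacc : (A.addScalar ω).IsAccretive) (x : A.domain) {t : ℝ} (ht : 0 ≤ t) :
    ‖Real.exp (-ω * t) • T.op t.toNNReal x‖ ≤ ‖(x : X)‖ := by
  set f : ℝ → X := fun r => Real.exp (-ω * r) • T.op r.toNNReal x with hf
  have hfc : Continuous f := by
    have := T.continuous_op_toNNReal x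
    fun_prop
  set b : ℝ → X := fun r => ω • T.op r.toNNReal x + A (T.onDomain hA r.toNNReal x) with hb
  have hd : ∀ r ∈ Ico 0 t, HasDerivWithinAt (fun r => (inner ℂ (f r) (f r)).re)
      (-(2 * (Real.exp (-ω * r) * Real.exp (-ω * r)) *
        (inner ℂ (b r) (T.op r.toNNReal x)).re))
      (Ici r) r := by
    intro r hr
    have he : HasDerivWithinAt (fun r : ℝ => Real.exp (-ω * r)) (Real.exp (-ω * r) * (-ω * 1))
        (Ici r) r := (((hasDerivAt_id r).const_mul (-ω)).exp).hasDerivWithinAt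
    have hval : Real.exp (-ω * r) • -A (T.onDomain hA r.toNNReal x) +
        (Real.exp (-ω * r) * (-ω * 1)) • T.op r.toNNReal x =
        -(Real.exp (-ω * r) • b r) := by
      rw [hb]
      module
    have hf' : HasDerivWithinAt f (-(Real.exp (-ω * r) • b r)) (Ici r) r :=
      (he.smul (hasDerivWithinAt_op hA x hr.1)).congr_deriv hval
    have h1 := Complex.reCLM.hasFDerivAt.comp_hasDerivWithinAt r (hf'.inner ℂ hf')
    refine h1.congr_deriv ?_
    have hsymm : (inner ℂ (T.op r.toNNReal (x : X)) (b r)).re =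
        (inner ℂ (b r) (T.op r.toNNReal (x : X))).re := inner_re_symm (𝕜 := ℂ) _ _
    simp only [hf, Complex.reCLM_apply, Complex.add_re, inner_neg_right, inner_neg_left,
      Complex.neg_re, ← Complex.coe_smul, inner_smul_left, inner_smul_right, Complex.conj_ofReal,
      Complex.re_ofReal_mul, hsymm]
    ring
  have hle := image_le_of_deriv_right_le_deriv_boundary (B := fun _ => ‖(x : X)‖ ^ 2)
    (B' := fun _ => 0) (Complex.continuous_re.comp (hfc.inner hfc)).continuousOn hd ?_
    continuousOn_const (fun r _ => hasDerivWithinAt_const _ _ _) ?_ (right_mem_Icc.2 ht)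
  · have h1 : (inner ℂ (f t) (f t)).re = ‖f t‖ ^ 2 := inner_self_eq_norm_sq (𝕜 := ℂ) (f t)
    exact (sq_le_sq₀ (norm_nonneg _) (norm_nonneg _)).1 (h1 ▸ hle)
  · have h1 : (inner ℂ (f 0) (f 0)).re = ‖f 0‖ ^ 2 := inner_self_eq_norm_sq (𝕜 := ℂ) (f 0)
    have h2 : f 0 = x := by
      simp only [hf, T.op_toNNReal_zero]
      simp
    exact (h1.trans (by rw [h2])).le
  · intro r _
    rw [neg_nonpos]
    exact mul_nonneg (by positivity) (hacc (T.onDomain hA r.toNNReal x : A.domain))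

theorem norm_exp_smul_op_le [CompleteSpace X] (hA : T.generator = -A)
    (hacc : (A.addScalar ω).IsAccretive) {t : ℝ} (ht : 0 ≤ t) (x : X) :
    ‖Real.exp (-ω * t) • T.op t.toNNReal x‖ ≤ ‖x‖ := by
  refine (dense_domain hA).induction (P := fun x => ‖Real.exp (-ω * t) • T.op t.toNNReal x‖ ≤ ‖x‖)
    (fun x hx => norm_exp_smul_op_le_of_mem_domain hA hacc ⟨x, hx⟩ ht) ?_ x
  exact isClosed_le (by fun_prop) (by fun_prop)

end Hilbert

end C0Semigroup

/-! ### Lower bounds for the output, and the theorem. -/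

namespace C0Semigroup

open Set

section Observation

variable {X : Type*} [NormedAddCommGroup X] [NormedSpace ℂ X]
  {Y : Type*} [NormedAddCommGroup Y] [NormedSpace ℂ Y]
  {T : C0Semigroup X} {A : X →ₗ.[ℂ] X} {ω : ℝ}

theorem norm_observation_le (hA : T.generator = -A) (hω : 0 ≤ ω)
    (h : ∀ t, 0 ≤ t → ∀ x, ‖Real.exp (-ω * t) • T.op t.toNNReal x‖ ≤ ‖x‖) {C : A.domain →ₗ[ℂ] Y} {M : ℝ}
    (hM0 : 0 ≤ M) (hM : ∀ x : A.domain, ‖C x‖ ≤ M * (‖(x : X)‖ + ‖A x‖)) (x : A.domain) {t : ℝ}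
    (ht : t ∈ Icc (0 : ℝ) 1) :
    ‖C (T.onDomain hA t.toNNReal x)‖ ≤ M * (Real.exp ω * (‖(x : X)‖ + ‖A x‖)) := by
  have hT : ∀ v, ‖T.op t.toNNReal v‖ ≤ Real.exp ω * ‖v‖ := by
    intro v
    have h1 := h t ht.1 v
    rw [norm_smul, Real.norm_of_nonneg (Real.exp_nonneg _)] at h1
    have h2 : Real.exp ω * Real.exp (-ω * t) ≥ 1 := by
      rw [← Real.exp_add]
      exact Real.one_le_exp (by nlinarith [ht.2])
    calc ‖T.op t.toNNReal v‖ = 1 * ‖T.op t.toNNReal v‖ := (one_mul _).symm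
      _ ≤ Real.exp ω * Real.exp (-ω * t) * ‖T.op t.toNNReal v‖ := by gcongr
      _ ≤ Real.exp ω * ‖v‖ := by rw [mul_assoc]; gcongr
  refine (hM _).trans ?_
  rw [apply_onDomain, mul_add (Real.exp ω)]
  gcongr
  · exact hT x
  · exact hT (A x)

variable [CompleteSpace X]
  {h : ∀ t, 0 ≤ t → ∀ x, ‖Real.exp (-ω * t) • T.op t.toNNReal x‖ ≤ ‖x‖}

/-- A lower bound of `C B^{-1/2}` bounds the output along orbits from below. -/
theorem le_norm_observation (hA : T.generator = -A) (hω : 0 ≤ ω) {C : A.domain →ₗ[ℂ] Y} {δ : ℝ}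
    (hlow : ∀ x : A.domain, ∃ z : A.domain,
      (A.addScalar ω).HasNegSqrt (x : X) (z : X) ∧ δ * ‖(x : X)‖ ≤ ‖C z‖)
    {y z : A.domain} (hyz : (T.toContraction ω h).HasNegSqrt (y : X) z) {t : ℝ} (ht : 0 ≤ t) :
    δ * ‖(T.toContraction ω h).op t y‖ ≤ ‖C (T.onDomain hA t.toNNReal z)‖ := by
  set c : ℂ := ((Real.exp (-ω * t) : ℝ) : ℂ) with hc
  -- The hypothesis is applied to S(t) y; uniqueness of limits identifies its witness with S(t) z.
  obtain ⟨z', hz', hle⟩ := hlow (c • T.onDomain hA t.toNNReal y)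
  have hy : ((c • T.onDomain hA t.toNNReal y : A.domain) : X) =
      (T.toContraction ω h).op t y := by
    rw [toContraction_op ht, ← Complex.coe_smul]
    rfl
  have hz : z' = c • T.onDomain hA t.toNNReal z := by
    refine Subtype.ext ?_
    rw [hy, hasNegSqrt_iff (h := h) hA] at hz'
    rw [tendsto_nhds_unique hz' (hyz.op ht), toContraction_op ht, ← Complex.coe_smul]
    rfl
  rw [hy, hz, map_smul, norm_smul] at hle
  refine hle.trans (mul_le_of_le_one_left (norm_nonneg _) ?_)
  rw [hc, Complex.norm_real, Real.norm_of_nonneg (Real.exp_nonneg _), Real.exp_le_one_iff]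
  nlinarith

end Observation

end C0Semigroup

theorem mainTheorem12
    {X : Type*} [NormedAddCommGroup X] [InnerProductSpace ℂ X] [CompleteSpace X]
    {Y : Type*} [NormedAddCommGroup Y] [NormedSpace ℂ Y] [CompleteSpace Y]
    (T : C0Semigroup X) (A : X →ₗ.[ℂ] X) (hA : T.generator = -A)
    (ω : ℝ) (hω : 0 < ω) (hacc : (A.addScalar ω).IsAccretive)
    (C : A.domain →ₗ[ℂ] Y) (hC : A.IsBoundedOnDomain C)
    (δ : ℝ) (hδ : 0 < δ)
    (hlow : ∀ x : A.domain, ∃ z : A.domain,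
      (A.addScalar ω).HasNegSqrt (x : X) (z : X) ∧ δ * ‖(x : X)‖ ≤ ‖C z‖) :
    ∃ η : ℝ, 0 < η ∧ T.ExactlyObservableInTime hA C η := by
  have hcontr : ∀ t, 0 ≤ t → ∀ x, ‖Real.exp (-ω * t) • T.op t.toNNReal x‖ ≤ ‖x‖ :=
    fun t ht x => C0Semigroup.norm_exp_smul_op_le hA hacc ht x
  set S := T.toContraction ω hcontr
  have hresmem : ∀ x, ∃ hx : S.res 1 x ∈ A.domain,
      A ⟨S.res 1 x, hx⟩ = x - (1 : ℝ) • S.res 1 x - ω • S.res 1 x := fun x =>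
    C0Semigroup.exists_mem_domain_of_hasGen hA (S.hasGen_res one_pos x)
  have hreseq : ∀ x : A.domain, S.res 1 ((1 : ℝ) • (x : X) + (ω • (x : X) + A x)) = x := fun x =>
    (C0Semigroup.toContraction_hasGen hA x).res_eq one_pos
  have hdom : ∀ x : A.domain, ∃ z : A.domain, S.HasNegSqrt (x : X) z := fun x =>
    (hlow x).imp fun z hz => (C0Semigroup.hasNegSqrt_iff hA).1 hz.1
  have hex : ∀ x, ∃ z, S.HasNegSqrt (S.res 1 x) z := fun x =>
    (hdom ⟨S.res 1 x, (hresmem x).1⟩).imp' _ fun z hz => hz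
  have hdense : Dense (Set.range (S.res 1)) :=
    (C0Semigroup.dense_domain hA).mono fun x hx => ⟨_, hreseq ⟨x, hx⟩⟩
  obtain ⟨K, hK0, hK⟩ := S.exists_norm_sq_le_integral_of_hasNegSqrt hex
  have hCc := fun x => C0Semigroup.continuous_observation hA hC x
  have hobs : ∀ y z : A.domain, S.HasNegSqrt (y : X) z → δ ^ 2 * ‖(z : X)‖ ^ 2 ≤
      K * ∫ t in (0 : ℝ)..1, ‖C (T.onDomain hA t.toNNReal z)‖ ^ 2 := by
    intro y z hyz
    calc δ ^ 2 * ‖(z : X)‖ ^ 2 ≤ δ ^ 2 * (K * ∫ t in (0 : ℝ)..1, ‖S.op t y‖ ^ 2) := by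
          gcongr
          exact hK y z hyz
      _ = K * ∫ t in (0 : ℝ)..1, (δ * ‖S.op t y‖) ^ 2 := by
          simp only [mul_pow]
          rw [intervalIntegral.integral_const_mul]
          ring
      _ ≤ _ := by
          refine mul_le_mul_of_nonneg_left ?_ hK0.le
          refine intervalIntegral.integral_mono_on zero_le_one
            ((((S.continuous_op y).norm.const_mul δ).pow 2).intervalIntegrable _ _)
            (((hCc z).norm.pow 2).intervalIntegrable _ _) fun t ht => ?_
          have := C0Semigroup.le_norm_observation hA hω.le hlow hyz ht.1
          gcongr
  obtain ⟨M, hM⟩ := hC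
  have hM' : ∀ x : A.domain, ‖C x‖ ≤ |M| * (‖(x : X)‖ + ‖A x‖) := fun x =>
    (hM x).trans (mul_le_mul_of_nonneg_right (le_abs_self M) (by positivity))
  have hall : ∀ x : A.domain, δ ^ 2 * ‖(x : X)‖ ^ 2 ≤
      K * (2 * ∫ t in (0 : ℝ)..1, ‖C (T.onDomain hA t.toNNReal x)‖ ^ 2) := by
    intro x
    set J := ∫ t in (0 : ℝ)..1, ‖C (T.onDomain hA t.toNNReal x)‖ ^ 2 with hJ
    -- Here v = (1 + B) x. Approximating v in norm by vectors of the range of B^{-1/2} and applying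
    -- (1 + B)⁻¹ approximates x in the graph norm.
    set v := (1 : ℝ) • (x : X) + (ω • (x : X) + A x) with hv
    obtain ⟨e, he, hev⟩ := mem_closure_iff_seq_limit.1 (S.dense_range_negSqrt hdense hex v)
    choose y hy using he
    let xn : ℕ → A.domain := fun n => ⟨S.res 1 (e n), (hresmem (e n)).1⟩
    have hAxn : ∀ n, A (xn n) = e n - (1 : ℝ) • S.res 1 (e n) - ω • S.res 1 (e n) := fun n =>
      (hresmem (e n)).2
    have hlim : Tendsto (fun n => S.res 1 (e n)) atTop (𝓝 (x : X)) := by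
      rw [← hreseq x]
      exact ((S.res 1).continuous.tendsto v).comp hev
    have hlimA : Tendsto (fun n => A (xn n)) atTop (𝓝 (A x)) := by
      have h1 := (hev.sub (hlim.const_smul (1 : ℝ))).sub (hlim.const_smul ω)
      simp only [hAxn]
      rwa [show v - (1 : ℝ) • (x : X) - ω • (x : X) = A x by rw [hv]; abel] at h1
    set r : ℕ → ℝ := fun n =>
      |M| * (Real.exp ω * (‖(xn n : X) - x‖ + ‖A (xn n) - A x‖))
    have hr0 : Tendsto r atTop (𝓝 0) := by
      have h1 := (((hlim.sub_const (x : X)).norm.add (hlimA.sub_const (A x)).norm).const_mul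
        (Real.exp ω)).const_mul |M|
      simpa using h1
    have hle : ∀ n, δ ^ 2 * ‖S.res 1 (e n)‖ ^ 2 ≤ K * (2 * J + 2 * r n ^ 2) := by
      intro n
      -- The approximant is itself a value of B^{-1/2}, since the resolvent commutes with B^{-1/2}.
      have h1 := hobs ⟨S.res 1 (S.res 1 (y n)), (hresmem _).1⟩ (xn n) ((hy n).res one_pos)
      refine h1.trans (mul_le_mul_of_nonneg_left ?_ hK0.le)
      have h2 : ∫ t in (0 : ℝ)..1, (2 * ‖C (T.onDomain hA t.toNNReal x)‖ ^ 2 + 2 * r n ^ 2) =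
          2 * J + 2 * r n ^ 2 := by
        have hCx : IntervalIntegrable (fun t : ℝ => 2 * ‖C (T.onDomain hA t.toNNReal x)‖ ^ 2)
            volume 0 1 := (((hCc x).norm.pow 2).const_mul 2).intervalIntegrable _ _
        rw [intervalIntegral.integral_add hCx (by simp), intervalIntegral.integral_const_mul, ← hJ]
        simp
      rw [← h2]
      refine intervalIntegral.integral_mono_on zero_le_one
        (((hCc (xn n)).norm.pow 2).intervalIntegrable _ _)
        (((((hCc x).norm.pow 2).const_mul 2).add continuous_const).intervalIntegrable _ _)
        fun t ht => ?_
      have h3 := C0Semigroup.norm_observation_le hA hω.le hcontr (abs_nonneg M) hM'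
        (xn n - x) ht
      have h4 : T.onDomain hA t.toNNReal (xn n) =
          T.onDomain hA t.toNNReal x + T.onDomain hA t.toNNReal (xn n - x) := by
        refine Subtype.ext ?_
        change T.op t.toNNReal (xn n : X) = T.op t.toNNReal x + T.op t.toNNReal ((xn n : X) - x)
        rw [← map_add, add_sub_cancel]
      rw [LinearPMap.map_sub] at h3
      have h5 : ‖C (T.onDomain hA t.toNNReal (xn n))‖ ≤
          ‖C (T.onDomain hA t.toNNReal x)‖ + r n := by
        rw [h4, map_add]
        exact (norm_add_le _ _).trans (by gcongr; exact h3)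
      have h6 := pow_le_pow_left₀ (norm_nonneg _) h5 2
      nlinarith [sq_nonneg (‖C (T.onDomain hA t.toNNReal x)‖ - r n)]
    have hl := le_of_tendsto_of_tendsto' ((hlim.norm.pow 2).const_mul (δ ^ 2))
      ((((hr0.pow 2).const_mul 2).const_add (2 * J)).const_mul K) hle
    simpa using hl
  -- The factor 2 is the price of (a + r)² ≤ 2a² + 2r² in the approximation.
  refine ⟨1, one_pos, √(δ ^ 2 / (2 * K)), Real.sqrt_pos.2 (by positivity), fun x hx => ?_⟩
  have h1 := hall x
  rw [hx] at h1
  rw [Real.sq_sqrt (by positivity), div_le_iff₀ (by positivity)]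
  linarith
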